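/- Let $1\le k<n$ be integers and let $\Bbbk$ be a field containing a primitive $n$-th root of unity. Let $Z$ be either $\Bbbk[t]$ or $\Bbbk[[t]]$, and put $$R=Z[x,y]/(xy-t,\;x^k-y^{n-k}),$$ so that $R=\Bbbk[x,y]/(x^k-y^{n-k})$ in the first case and $R=\Bbbk[[x,y]]/(x^k-y^{n-k})$ in the second. Let $G=\{\zeta\in\Bbbk^*:\zeta^n=1\}$ act on $R$ by $Z$-algebra automorphisms via $x\mapsto\zeta x$, $y\mapsto\zeta^{-1}y$, and let $A=R*G$ be the twisted group ring. Identify $\{1,\dots,n\}$ with $\mathbb Z/n$. For a $k$-subset $I$ of $\{1,\dots,n\}$ let $L_I$ be the (left) $A$-module $\bigoplus_{i\in\mathbb Z/n}e_iL_I$ with $e_iL_I=Z$, on which $\zeta\in G$ acts on $e_iL_I$ as multiplication by $\zeta^i$, and $x$, $y$ act, for each $a\in\mathbb Z/n$, by the maps $$x\colon e_{a-1}L_I\to e_aL_I,\qquad y\colon e_aL_I\to e_{a-1}L_I$$ that are multiplication by $1$ and $t$ respectively if $a\in I$, and by $t$ and $1$ respectively if $a\notin I$. Two $k$-subsets $I,J$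 of $\{1,\dots,n\}$ are called *non-crossing* (or *weakly separated*) if there are no cyclically ordered $a,b,c,d$ with $a,c\in I\setminus J$ and $b,d\in J\setminus I$. **Proposition.** In both cases ($Z=\Bbbk[t]$ and $Z=\Bbbk[[t]]$), for all $k$-subsets $I,J$ of $\{1,\dots,n\}$, $$\operatorname{Ext}^1_A(L_I,L_J)=0\quad\Longleftrightarrow\quad I\text{ and }J\text{ are non-crossing}.$$ -/

import Mathlib

open CategoryTheory

universe u

noncomputable section

namespace JKS

/-! ### The ring `R` and the action of the group `G` of `n`-th roots of unity -/

/-- The group `G` of `n`-th roots of unity in `𝕜`. It is a type of its own so that its action on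
`R` below is not confused with the multiplication by scalars of `𝕜`. -/
def G (𝕜 : Type u) [Field 𝕜] (n : ℕ) : Type u := rootsOfUnity n 𝕜

instance (𝕜 : Type u) [Field 𝕜] (n : ℕ) : CommGroup (G 𝕜 n) :=
  inferInstanceAs (CommGroup (rootsOfUnity n 𝕜))

/-- The inclusion of `G` in `𝕜ˣ`. -/
def G.unit {𝕜 : Type u} [Field 𝕜] {n : ℕ} (g : G 𝕜 n) : 𝕜ˣ := Subtype.val (p := (· ∈ rootsOfUnity n 𝕜)) g

theorem G.unit_pow {𝕜 : Type u} [Field 𝕜] {n : ℕ} (g : G 𝕜 n) : g.unit ^ n = 1 :=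
  (mem_rootsOfUnity n _).mp (Subtype.property (p := (· ∈ rootsOfUnity n 𝕜)) g)

theorem G.unit_one {𝕜 : Type u} [Field 𝕜] {n : ℕ} : (1 : G 𝕜 n).unit = 1 := rfl

theorem G.unit_mul {𝕜 : Type u} [Field 𝕜] {n : ℕ} (g h : G 𝕜 n) :
    (g * h).unit = g.unit * h.unit := rfl

section Ring

variable {Z : Type u} [CommRing Z]

/-- The ideal `(x y - t, x ^ k - y ^ (n - k))` of `Z[x, y]`. -/
def relIdeal (n k : ℕ) (t : Z) : Ideal (MvPolynomial (Fin 2) Z) :=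
  Ideal.span {MvPolynomial.X 0 * MvPolynomial.X 1 - MvPolynomial.C t,
    MvPolynomial.X 0 ^ k - MvPolynomial.X 1 ^ (n - k)}

/-- The ring `R = Z[x, y] / (x y - t, x ^ k - y ^ (n - k))`.

For `Z = 𝕜[t]` this is `𝕜[x, y] / (x ^ k - y ^ (n - k))`, with `t = x y`.
For `Z = 𝕜⟦t⟧` it is the base change of the former along `𝕜[t] → 𝕜⟦t⟧`, that is,
the complete ring `𝕜⟦x, y⟧ / (x ^ k - y ^ (n - k))`. -/
abbrev R (n k : ℕ) (t : Z) : Type u := MvPolynomial (Fin 2) Z ⧸ relIdeal n k t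

/-- The class of `x` in `R`. -/
def xR (n k : ℕ) (t : Z) : R n k t := Ideal.Quotient.mk _ (MvPolynomial.X 0)

/-- The class of `y` in `R`. -/
def yR (n k : ℕ) (t : Z) : R n k t := Ideal.Quotient.mk _ (MvPolynomial.X 1)

variable {𝕜 : Type u} [Field 𝕜] [Algebra 𝕜 Z]

/-- The `Z`-algebra endomorphism `x ↦ c x`, `y ↦ c⁻¹ y` of `Z[x, y]`, for `c ∈ 𝕜ˣ`. -/
def scaleXY (Z : Type u) [CommRing Z] [Algebra 𝕜 Z] (c : 𝕜ˣ) :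
    MvPolynomial (Fin 2) Z →ₐ[Z] MvPolynomial (Fin 2) Z :=
  MvPolynomial.aeval
    ![MvPolynomial.C (algebraMap 𝕜 Z (c : 𝕜)) * MvPolynomial.X 0,
      MvPolynomial.C (algebraMap 𝕜 Z ((c⁻¹ : 𝕜ˣ) : 𝕜)) * MvPolynomial.X 1]

theorem scaleXY_X0 (c : 𝕜ˣ) : scaleXY Z c (MvPolynomial.X 0) =
    MvPolynomial.C (algebraMap 𝕜 Z (c : 𝕜)) * MvPolynomial.X 0 := by
  simp [scaleXY]

theorem scaleXY_X1 (c : 𝕜ˣ) : scaleXY Z c (MvPolynomial.X 1) =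
    MvPolynomial.C (algebraMap 𝕜 Z ((c⁻¹ : 𝕜ˣ) : 𝕜)) * MvPolynomial.X 1 := by
  simp [scaleXY]

theorem scaleXY_C (c : 𝕜ˣ) (z : Z) :
    scaleXY Z c (MvPolynomial.C z) = MvPolynomial.C z := by
  simp [scaleXY]

theorem algebraMap_mul_inv (c : 𝕜ˣ) :
    algebraMap 𝕜 Z (c : 𝕜) * algebraMap 𝕜 Z ((c⁻¹ : 𝕜ˣ) : 𝕜) = 1 := by
  rw [← map_mul, Units.mul_inv, map_one]

theorem scaleXY_one : scaleXY Z (1 : 𝕜ˣ) = AlgHom.id Z _ := by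
  apply MvPolynomial.algHom_ext
  intro i
  fin_cases i <;> simp [scaleXY]

theorem scaleXY_mul (c d : 𝕜ˣ) :
    scaleXY Z (c * d) = (scaleXY Z c).comp (scaleXY Z d) := by
  apply MvPolynomial.algHom_ext
  intro i
  fin_cases i
  · change scaleXY Z (c * d) (MvPolynomial.X 0) = scaleXY Z c (scaleXY Z d (MvPolynomial.X 0))
    rw [scaleXY_X0, scaleXY_X0, map_mul, scaleXY_C, scaleXY_X0, Units.val_mul, map_mul, map_mul]
    ring
  · change scaleXY Z (c * d) (MvPolynomial.X 1) = scaleXY Z c (scaleXY Z d (MvPolynomial.X 1))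
    rw [scaleXY_X1, scaleXY_X1, map_mul, scaleXY_C, scaleXY_X1, mul_inv, Units.val_mul, map_mul,
      map_mul]
    ring

/-- For `g ^ n = 1` the substitution `x ↦ g x`, `y ↦ g⁻¹ y` fixes `x y - t` and multiplies
`x ^ k - y ^ (n - k)` by `g ^ k`. -/
theorem relIdeal_le_comap {n k : ℕ} (hk : k < n) (t : Z) (g : 𝕜ˣ) (hg : g ^ n = 1) :
    relIdeal n k t ≤ (relIdeal n k t).comap (scaleXY Z g) := by
  refine Ideal.span_le.mpr ?_
  rintro p (rfl | rfl)
  · have h : scaleXY Z g (MvPolynomial.X 0 * MvPolynomial.X 1 - MvPolynomial.C t) =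
        MvPolynomial.X 0 * MvPolynomial.X 1 - MvPolynomial.C t := by
      rw [map_sub, map_mul, scaleXY_X0, scaleXY_X1, scaleXY_C]
      have := congrArg (MvPolynomial.C (σ := Fin 2)) (algebraMap_mul_inv (Z := Z) g)
      rw [map_mul, map_one] at this
      linear_combination (MvPolynomial.X 0 * MvPolynomial.X 1) * this
    rw [SetLike.mem_coe, Ideal.mem_comap, h]
    exact Ideal.subset_span (by simp)
  · have hinv : (g⁻¹) ^ (n - k) = g ^ k := by
      rw [inv_pow, inv_eq_iff_mul_eq_one, ← pow_add, Nat.sub_add_cancel hk.le, hg]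
    have h : scaleXY Z g (MvPolynomial.X 0 ^ k - MvPolynomial.X 1 ^ (n - k)) =
        MvPolynomial.C (algebraMap 𝕜 Z ((g ^ k : 𝕜ˣ) : 𝕜)) *
          (MvPolynomial.X 0 ^ k - MvPolynomial.X 1 ^ (n - k)) := by
      rw [map_sub, map_pow, map_pow, scaleXY_X0, scaleXY_X1, mul_pow, mul_pow, ← map_pow,
        ← map_pow, ← map_pow, ← map_pow, ← Units.val_pow_eq_pow_val, ← Units.val_pow_eq_pow_val,
        hinv, mul_sub]
    rw [SetLike.mem_coe, Ideal.mem_comap, h]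
    exact Ideal.mul_mem_left _ _ (Ideal.subset_span (by simp))

/-- An `n`-th root of unity `g ∈ 𝕜` acts on `R` by the `Z`-algebra endomorphism
`x ↦ g x`, `y ↦ g⁻¹ y`. -/
def scaleR (n k : ℕ) [hkn : Fact (k < n)] (t : Z) (g : G 𝕜 n) :
    R n k t →ₐ[Z] R n k t :=
  Ideal.quotientMapₐ (relIdeal n k t) (scaleXY Z g.unit)
    (relIdeal_le_comap hkn.out t g.unit g.unit_pow)

/-- The action of the group `G` of `n`-th roots of unity of `𝕜` on the ring `R`. -/
instance instActionR (n k : ℕ) [Fact (k < n)] (t : Z) :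
    MulSemiringAction (G 𝕜 n) (R n k t) where
  smul g r := scaleR n k t g r
  one_smul r := by
    obtain ⟨p, rfl⟩ := Ideal.Quotient.mk_surjective r
    change Ideal.Quotient.mk (relIdeal n k t) (scaleXY Z (1 : 𝕜ˣ) p) = _
    rw [scaleXY_one]
    rfl
  mul_smul g h r := by
    obtain ⟨p, rfl⟩ := Ideal.Quotient.mk_surjective r
    change Ideal.Quotient.mk (relIdeal n k t) (scaleXY Z (g.unit * h.unit) p) = _
    rw [scaleXY_mul]
    rfl
  smul_zero g := map_zero (scaleR n k t g)
  smul_add g := map_add (scaleR n k t g)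
  smul_one g := map_one (scaleR n k t g)
  smul_mul g := map_mul (scaleR n k t g)

theorem smul_xR (n k : ℕ) [Fact (k < n)] (t : Z) (g : G 𝕜 n) :
    g • xR n k t = algebraMap Z (R n k t) (algebraMap 𝕜 Z (g.unit : 𝕜)) * xR n k t := by
  change Ideal.Quotient.mk (relIdeal n k t) (scaleXY Z g.unit (MvPolynomial.X 0)) = _
  rw [scaleXY_X0, map_mul]
  rfl

theorem smul_yR (n k : ℕ) [Fact (k < n)] (t : Z) (g : G 𝕜 n) :
    g • yR n k t =
      algebraMap Z (R n k t) (algebraMap 𝕜 Z ((g.unit⁻¹ : 𝕜ˣ) : 𝕜)) * yR n k t := by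
  change Ideal.Quotient.mk (relIdeal n k t) (scaleXY Z g.unit (MvPolynomial.X 1)) = _
  rw [scaleXY_X1, map_mul]
  rfl

theorem smul_algebraMap_R (n k : ℕ) [Fact (k < n)] (t : Z) (g : G 𝕜 n) (z : Z) :
    g • algebraMap Z (R n k t) z = algebraMap Z (R n k t) z :=
  (scaleR n k t g).commutes z

end Ring

/-- The algebra `A = R * G`, the twisted group ring of the group `G` of `n`-th roots of unity of
`𝕜` over `R`: finite sums `∑ r_g g` with `(r g) (s h) = r (g • s) (g h)`. -/
abbrev A (𝕜 : Type u) [Field 𝕜] {Z : Type u} [CommRing Z] [Algebra 𝕜 Z] (n k : ℕ)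
    [Fact (k < n)] (t : Z) : Type u :=
  SkewMonoidAlgebra (R n k t) (G 𝕜 n)

/-! ### The rank one modules -/

/-- The `k`-subsets of `{1, …, n}`, whose elements are read modulo `n`. -/
abbrev KSubset (n k : ℕ) : Type := {I : Finset (ZMod n) // I.card = k}

section RankOne

variable {Z : Type u} [CommRing Z] {n : ℕ}

/-- `x_a : Z → Z` (from vertex `a - 1` to vertex `a`) is `1` if `a ∈ I`, and `t` if not. -/
def xCoeff (I : Finset (ZMod n)) (t : Z) (a : ZMod n) : Z := if a ∈ I then 1 else t

/-- `y_a : Z → Z` (from vertex `a` to vertex `a - 1`) is `t` if `a ∈ I`, and `1` if not. -/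
def yCoeff (I : Finset (ZMod n)) (t : Z) (a : ZMod n) : Z := if a ∈ I then t else 1

/-- The sum of all the maps `x_a` on `⨁_{i ∈ ℤ/n} Z`. -/
def xEnd (I : Finset (ZMod n)) (t : Z) : Module.End Z (ZMod n → Z) where
  toFun v i := xCoeff I t i * v (i - 1)
  map_add' v w := by funext i; simp [mul_add]
  map_smul' z v := by funext i; simp [mul_left_comm]

/-- The sum of all the maps `y_a` on `⨁_{i ∈ ℤ/n} Z`. -/
def yEnd (I : Finset (ZMod n)) (t : Z) : Module.End Z (ZMod n → Z) where
  toFun v i := yCoeff I t (i + 1) * v (i + 1)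
  map_add' v w := by funext i; simp [mul_add]
  map_smul' z v := by funext i; simp [mul_left_comm]

theorem xCoeff_mul_yCoeff (I : Finset (ZMod n)) (t : Z) (a : ZMod n) :
    xCoeff I t a * yCoeff I t a = t := by
  unfold xCoeff yCoeff; split_ifs <;> simp

theorem xEnd_mul_yEnd (I : Finset (ZMod n)) (t : Z) :
    xEnd I t * yEnd I t = algebraMap Z _ t := by
  apply LinearMap.ext; intro v; funext i
  change xCoeff I t i * (yCoeff I t (i - 1 + 1) * v (i - 1 + 1)) = t * v i
  rw [sub_add_cancel, ← mul_assoc, xCoeff_mul_yCoeff]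

theorem yEnd_mul_xEnd (I : Finset (ZMod n)) (t : Z) :
    yEnd I t * xEnd I t = algebraMap Z _ t := by
  apply LinearMap.ext; intro v; funext i
  change yCoeff I t (i + 1) * (xCoeff I t (i + 1) * v (i + 1 - 1)) = t * v i
  rw [add_sub_cancel_right, ← mul_assoc, mul_comm (yCoeff I t _), xCoeff_mul_yCoeff]

theorem xEnd_pow_apply (I : Finset (ZMod n)) (t : Z) (m : ℕ) (v : ZMod n → Z) (i : ZMod n) :
    (xEnd I t ^ m) v i = (∏ j ∈ Finset.range m, xCoeff I t (i - j)) * v (i - m) := by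
  induction m generalizing i with
  | zero => simp
  | succ m ih =>
    rw [pow_succ', Module.End.mul_apply]
    change xCoeff I t i * (xEnd I t ^ m) v (i - 1) = _
    rw [ih, Finset.prod_range_succ']
    have h (j : ℕ) : i - 1 - (j : ZMod n) = i - ((j + 1 : ℕ) : ZMod n) := by push_cast; ring
    simp only [h, Nat.cast_zero, sub_zero]
    ring

theorem yEnd_pow_apply (I : Finset (ZMod n)) (t : Z) (m : ℕ) (v : ZMod n → Z) (i : ZMod n) :
    (yEnd I t ^ m) v i = (∏ j ∈ Finset.range m, yCoeff I t (i + 1 + j)) * v (i + m) := by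
  induction m generalizing i with
  | zero => simp
  | succ m ih =>
    rw [pow_succ', Module.End.mul_apply]
    change yCoeff I t (i + 1) * (yEnd I t ^ m) v (i + 1) = _
    rw [ih, Finset.prod_range_succ']
    have h (j : ℕ) : i + 1 + 1 + (j : ZMod n) = i + 1 + ((j + 1 : ℕ) : ZMod n) := by
      push_cast; ring
    have h' : i + 1 + (m : ZMod n) = i + ((m + 1 : ℕ) : ZMod n) := by push_cast; ring
    simp only [h, h', Nat.cast_zero, add_zero]
    ring

/-- The paths `x ^ k` and `y ^ (n - k)` into a vertex `i` use complementary sets of edges. -/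
theorem range_image_union {k : ℕ} (i : ZMod n) [NeZero n] :
    (Finset.range k).image (fun j : ℕ => i - (j : ZMod n)) ∪
      (Finset.range (n - k)).image (fun j : ℕ => i + 1 + (j : ZMod n)) = Finset.univ := by
  ext a
  simp only [Finset.mem_union, Finset.mem_image, Finset.mem_range, Finset.mem_univ, iff_true]
  by_cases h : (i - a).val < k
  · exact Or.inl ⟨(i - a).val, h, by simp⟩
  · refine Or.inr ⟨n - 1 - (i - a).val, ?_, ?_⟩
    · have := ZMod.val_lt (i - a); omega
    · have hl := ZMod.val_lt (i - a)
      rw [Nat.sub_sub, Nat.cast_sub (by omega)]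
      simp
      ring

theorem cast_injOn {m : ℕ} (hm : m ≤ n) :
    Set.InjOn (fun j : ℕ => (j : ZMod n)) (Finset.range m) := by
  intro a ha b hb hab
  have ha' : a < m := by simpa using ha
  have hb' : b < m := by simpa using hb
  have := (ZMod.natCast_eq_natCast_iff' a b n).mp hab
  rwa [Nat.mod_eq_of_lt (by omega), Nat.mod_eq_of_lt (by omega)] at this

theorem xEnd_pow_eq_yEnd_pow {k : ℕ} (hkn : k < n) (I : KSubset n k) (t : Z) :
    xEnd I.1 t ^ k = yEnd I.1 t ^ (n - k) := by
  have : NeZero n := ⟨by omega⟩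
  apply LinearMap.ext; intro v; funext i
  rw [xEnd_pow_apply, yEnd_pow_apply]
  have hv : i - (k : ZMod n) = i + ((n - k : ℕ) : ZMod n) := by
    rw [Nat.cast_sub hkn.le]; simp [sub_eq_add_neg]
  rw [hv]
  congr 1
  set S := (Finset.range k).image (fun j : ℕ => i - (j : ZMod n)) with hS
  set T := (Finset.range (n - k)).image (fun j : ℕ => i + 1 + (j : ZMod n)) with hT
  have hSinj : Set.InjOn (fun j : ℕ => i - (j : ZMod n)) (Finset.range k) := by
    intro a ha b hb hab
    exact cast_injOn hkn.le ha hb (sub_right_injective hab)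
  have hTinj : Set.InjOn (fun j : ℕ => i + 1 + (j : ZMod n)) (Finset.range (n - k)) := by
    intro a ha b hb hab
    exact cast_injOn (Nat.sub_le n k) ha hb (add_right_injective _ hab)
  have hScard : S.card = k := by
    rw [hS, Finset.card_image_of_injOn hSinj, Finset.card_range]
  have hTcard : T.card = n - k := by
    rw [hT, Finset.card_image_of_injOn hTinj, Finset.card_range]
  have hU : S ∪ T = Finset.univ := range_image_union i
  have hD : Disjoint S T := by
    rw [← Finset.card_union_eq_card_add_card, hU, Finset.card_univ, ZMod.card]
    omega
  have e1 : ∏ j ∈ Finset.range k, xCoeff I.1 t (i - j) = ∏ a ∈ S, xCoeff I.1 t a := by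
    rw [hS, Finset.prod_image hSinj]
  have e2 : ∏ j ∈ Finset.range (n - k), yCoeff I.1 t (i + 1 + j) = ∏ a ∈ T, yCoeff I.1 t a := by
    rw [hT, Finset.prod_image hTinj]
  rw [e1, e2]
  unfold xCoeff yCoeff
  rw [Finset.prod_ite, Finset.prod_ite]
  simp only [Finset.prod_const_one, Finset.prod_const, one_mul, mul_one]
  congr 1
  have h1 := Finset.card_filter_add_card_filter_not (s := S) (fun a => a ∈ I.1)
  have h2 : (S.filter (fun a => a ∈ I.1)).card + (T.filter (fun a => a ∈ I.1)).card = k := by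
    rw [← Finset.card_union_of_disjoint (Finset.disjoint_filter_filter hD),
      ← Finset.filter_union, hU]
    simpa using I.2
  omega

/-- The two commuting endomorphisms through which `x` and `y` act on `L_I`. -/
def xyEnd (I : Finset (ZMod n)) (t : Z) : Fin 2 → Module.End Z (ZMod n → Z) :=
  ![xEnd I t, yEnd I t]

theorem xyEnd_comm (I : Finset (ZMod n)) (t : Z) :
    ∀ a ∈ Set.range (xyEnd I t), ∀ b ∈ Set.range (xyEnd I t), a * b = b * a := by
  rintro _ ⟨i, rfl⟩ _ ⟨j, rfl⟩
  fin_cases i <;> fin_cases j <;> simp [xyEnd, xEnd_mul_yEnd, yEnd_mul_xEnd]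

/-- `Z[x, y]` acts on `⨁_{i ∈ ℤ/n} Z` through `xEnd` and `yEnd`. (As `Module.End` is not
commutative, the evaluation takes place in the commutative subalgebra generated by the two.) -/
def polyEnd (I : Finset (ZMod n)) (t : Z) :
    MvPolynomial (Fin 2) Z →ₐ[Z] Module.End Z (ZMod n → Z) :=
  letI : CommRing (Algebra.adjoin Z (Set.range (xyEnd I t))) :=
    { (inferInstance : Ring (Algebra.adjoin Z (Set.range (xyEnd I t)))) with
      mul_comm := (Algebra.isMulCommutative_adjoin Z (xyEnd_comm I t)).is_comm.comm }
  (Algebra.adjoin Z (Set.range (xyEnd I t))).val.comp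
    (MvPolynomial.aeval fun i => ⟨xyEnd I t i, Algebra.subset_adjoin ⟨i, rfl⟩⟩)

theorem polyEnd_X (I : Finset (ZMod n)) (t : Z) (i : Fin 2) :
    polyEnd I t (MvPolynomial.X i) = xyEnd I t i := by
  let _ : CommRing (Algebra.adjoin Z (Set.range (xyEnd I t))) :=
    { (inferInstance : Ring (Algebra.adjoin Z (Set.range (xyEnd I t)))) with
      mul_comm := (Algebra.isMulCommutative_adjoin Z (xyEnd_comm I t)).is_comm.comm }
  change (Algebra.adjoin Z (Set.range (xyEnd I t))).val (MvPolynomial.aeval _ _) = _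
  rw [MvPolynomial.aeval_X]
  rfl

/-- `R` acts on `⨁_{i ∈ ℤ/n} Z` through `xEnd` and `yEnd`. -/
def ringEnd {k : ℕ} [hkn : Fact (k < n)] (I : KSubset n k) (t : Z) :
    R n k t →ₐ[Z] Module.End Z (ZMod n → Z) :=
  Ideal.Quotient.liftₐ (relIdeal n k t) (polyEnd I.1 t) (by
    have h : relIdeal n k t ≤ RingHom.ker (polyEnd I.1 t) := by
      refine Ideal.span_le.mpr ?_
      rintro p (rfl | rfl)
      · rw [SetLike.mem_coe, RingHom.mem_ker, map_sub, map_mul, polyEnd_X, polyEnd_X,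
          MvPolynomial.algHom_C, sub_eq_zero]
        exact xEnd_mul_yEnd I.1 t
      · rw [SetLike.mem_coe, RingHom.mem_ker, map_sub, map_pow, map_pow, polyEnd_X, polyEnd_X,
          sub_eq_zero]
        exact xEnd_pow_eq_yEnd_pow hkn.out I t
    exact fun a ha => h ha)

theorem ringEnd_xR {k : ℕ} [Fact (k < n)] (I : KSubset n k) (t : Z) :
    ringEnd I t (xR n k t) = xEnd I.1 t :=
  polyEnd_X I.1 t 0

theorem ringEnd_yR {k : ℕ} [Fact (k < n)] (I : KSubset n k) (t : Z) :
    ringEnd I t (yR n k t) = yEnd I.1 t :=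
  polyEnd_X I.1 t 1

variable {𝕜 : Type u} [Field 𝕜] [Algebra 𝕜 Z]

/-- `g ∈ G` acts on the summand at the vertex `i ∈ ℤ/n` by the character `g ↦ g ^ i`. -/
def groupEnd (Z : Type u) [CommRing Z] [Algebra 𝕜 Z] (n : ℕ) :
    G 𝕜 n →* Module.End Z (ZMod n → Z) where
  toFun g :=
    { toFun := fun v i => algebraMap 𝕜 Z ((g.unit ^ i.val : 𝕜ˣ) : 𝕜) * v i
      map_add' := fun v w => by funext i; simp [mul_add]
      map_smul' := fun z v => by funext i; simp [mul_left_comm] }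
  map_one' := by apply LinearMap.ext; intro v; funext i; simp [G.unit_one]
  map_mul' g h := by
    apply LinearMap.ext; intro v; funext i
    simp [G.unit_mul, mul_pow, mul_assoc]

theorem groupEnd_apply (g : G 𝕜 n) (v : ZMod n → Z) (i : ZMod n) :
    groupEnd Z n g v i = algebraMap 𝕜 Z ((g.unit ^ i.val : 𝕜ˣ) : 𝕜) * v i := rfl

theorem pow_val_succ [NeZero n] (g : G 𝕜 n) (i : ZMod n) :
    g.unit ^ (i + 1).val = g.unit * g.unit ^ i.val := by
  have hg : g.unit ^ n = 1 := g.unit_pow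
  rw [← pow_succ', pow_eq_pow_iff_modEq]
  refine Nat.ModEq.of_dvd (orderOf_dvd_of_pow_eq_one hg) ?_
  rw [← ZMod.natCast_eq_natCast_iff]
  simp

theorem groupEnd_xEnd [NeZero n] (I : Finset (ZMod n)) (t : Z) (g : G 𝕜 n) :
    algebraMap Z _ (algebraMap 𝕜 Z (g.unit : 𝕜)) * xEnd I t * groupEnd Z n g =
      groupEnd Z n g * xEnd I t := by
  apply LinearMap.ext; intro v; funext i
  change algebraMap 𝕜 Z (g.unit : 𝕜) * (xCoeff I t i * (groupEnd Z n g v (i - 1))) =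
    groupEnd Z n g (xEnd I t v) i
  rw [groupEnd_apply, groupEnd_apply]
  change _ = _ * (xCoeff I t i * v (i - 1))
  have h := pow_val_succ g (i - 1)
  rw [sub_add_cancel] at h
  rw [h, Units.val_mul, map_mul]
  ring

theorem groupEnd_yEnd [NeZero n] (I : Finset (ZMod n)) (t : Z) (g : G 𝕜 n) :
    algebraMap Z _ (algebraMap 𝕜 Z ((g.unit⁻¹ : 𝕜ˣ) : 𝕜)) * yEnd I t * groupEnd Z n g =
      groupEnd Z n g * yEnd I t := by
  apply LinearMap.ext; intro v; funext i
  change algebraMap 𝕜 Z ((g.unit⁻¹ : 𝕜ˣ) : 𝕜) *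
      (yCoeff I t (i + 1) * (groupEnd Z n g v (i + 1))) = groupEnd Z n g (yEnd I t v) i
  rw [groupEnd_apply, groupEnd_apply]
  change _ = _ * (yCoeff I t (i + 1) * v (i + 1))
  rw [pow_val_succ g i, Units.val_mul, map_mul]
  linear_combination (yCoeff I t (i + 1) * v (i + 1) *
    algebraMap 𝕜 Z ((g.unit ^ i.val : 𝕜ˣ) : 𝕜)) * algebraMap_mul_inv (Z := Z) g.unit

theorem ringEnd_smul {k : ℕ} [hkn : Fact (k < n)] (I : KSubset n k) (t : Z)
    (g : G 𝕜 n) (r : R n k t) :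
    ringEnd I t (g • r) * groupEnd Z n g = groupEnd Z n g * ringEnd I t r := by
  have : NeZero n := ⟨by have := hkn.out; omega⟩
  obtain ⟨p, rfl⟩ := Ideal.Quotient.mk_surjective r
  induction p using MvPolynomial.induction_on with
  | C z =>
    change ringEnd I t (g • algebraMap Z (R n k t) z) * _ =
      _ * ringEnd I t (algebraMap Z (R n k t) z)
    rw [smul_algebraMap_R, AlgHom.commutes]
    exact Algebra.commutes _ _
  | add p q hp hq => rw [map_add, smul_add, map_add, map_add, add_mul, mul_add, hp, hq]
  | mul_X p i hp =>
    have hi : ringEnd I t (g • (Ideal.Quotient.mk (relIdeal n k t) (MvPolynomial.X i))) *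
        groupEnd Z n g = groupEnd Z n g *
          ringEnd I t (Ideal.Quotient.mk (relIdeal n k t) (MvPolynomial.X i)) := by
      fin_cases i
      · change ringEnd I t (g • xR n k t) * _ = _ * ringEnd I t (xR n k t)
        rw [smul_xR, map_mul, AlgHom.commutes, ringEnd_xR, groupEnd_xEnd]
      · change ringEnd I t (g • yR n k t) * _ = _ * ringEnd I t (yR n k t)
        rw [smul_yR, map_mul, AlgHom.commutes, ringEnd_yR, groupEnd_yEnd]
    rw [map_mul, smul_mul', map_mul, map_mul, mul_assoc, hi, ← mul_assoc, hp, mul_assoc]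

/-- The action of the twisted group ring `A = R * G` on `⨁_{i ∈ ℤ/n} Z` for which `x`, `y` act
through the maps `x_a`, `y_a` attached to `I` and the summand at `i` is the eigenspace of
character `g ↦ g ^ i`. -/
def algEnd {k : ℕ} [Fact (k < n)] (I : KSubset n k) (t : Z) :
    A 𝕜 n k t →+* Module.End Z (ZMod n → Z) :=
  SkewMonoidAlgebra.liftNCRingHom (ringEnd I t : R n k t →+* Module.End Z (ZMod n → Z))
    (groupEnd Z n) (fun {r g} => ringEnd_smul I t g r)

/-- The underlying group `⨁_{i ∈ ℤ/n} Z` of the rank one module `L_I`. -/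
def L {k : ℕ} (_I : KSubset n k) (Z : Type u) : Type u := ZMod n → Z

instance {k : ℕ} (I : KSubset n k) : AddCommGroup (L I Z) :=
  inferInstanceAs (AddCommGroup (ZMod n → Z))

/-- `End_Z(⨁ Z)` acts on `L_I`. -/
instance {k : ℕ} (I : KSubset n k) : Module (Module.End Z (ZMod n → Z)) (L I Z) :=
  inferInstanceAs (Module (Module.End Z (ZMod n → Z)) (ZMod n → Z))

/-- The `A`-module structure of `L_I`. -/
instance instModuleL {k : ℕ} [Fact (k < n)] (I : KSubset n k) (t : Z) :
    Module (A 𝕜 n k t) (L I Z) :=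
  Module.compHom (L I Z) (algEnd (𝕜 := 𝕜) I t)

/-- `x` acts on `L_I` by the maps `x_a : e_{a-1} L_I → e_a L_I`. -/
theorem x_smul_apply {k : ℕ} [Fact (k < n)] (I : KSubset n k) (t : Z) (v : L I Z) (i : ZMod n) :
    ((SkewMonoidAlgebra.single 1 (xR n k t) : A 𝕜 n k t) • v : L I Z) i =
      (if i ∈ I.1 then 1 else t) * v (i - 1) := by
  change (algEnd (𝕜 := 𝕜) I t (SkewMonoidAlgebra.single 1 (xR n k t))) v i = _
  have h : algEnd (𝕜 := 𝕜) I t (SkewMonoidAlgebra.single 1 (xR n k t)) = xEnd I.1 t := by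
    refine (SkewMonoidAlgebra.liftNC_single _ _ _ _).trans ?_
    rw [map_one, mul_one]
    exact ringEnd_xR I t
  rw [h]
  rfl

/-- `y` acts on `L_I` by the maps `y_a : e_a L_I → e_{a-1} L_I`. -/
theorem y_smul_apply {k : ℕ} [Fact (k < n)] (I : KSubset n k) (t : Z) (v : L I Z) (i : ZMod n) :
    ((SkewMonoidAlgebra.single 1 (yR n k t) : A 𝕜 n k t) • v : L I Z) i =
      (if i + 1 ∈ I.1 then t else 1) * v (i + 1) := by
  change (algEnd (𝕜 := 𝕜) I t (SkewMonoidAlgebra.single 1 (yR n k t))) v i = _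
  have h : algEnd (𝕜 := 𝕜) I t (SkewMonoidAlgebra.single 1 (yR n k t)) = yEnd I.1 t := by
    refine (SkewMonoidAlgebra.liftNC_single _ _ _ _).trans ?_
    rw [map_one, mul_one]
    exact ringEnd_yR I t
  rw [h]
  rfl

/-- `g ∈ G` acts on `e_i L_I` by `g ^ i`. -/
theorem g_smul_apply {k : ℕ} [Fact (k < n)] (I : KSubset n k) (t : Z) (g : G 𝕜 n)
    (v : L I Z) (i : ZMod n) :
    ((SkewMonoidAlgebra.single g 1 : A 𝕜 n k t) • v : L I Z) i =
      algebraMap 𝕜 Z ((g.unit ^ i.val : 𝕜ˣ) : 𝕜) * v i := by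
  change (algEnd (𝕜 := 𝕜) I t (SkewMonoidAlgebra.single g 1)) v i = _
  have h : algEnd (𝕜 := 𝕜) I t (SkewMonoidAlgebra.single g 1) = groupEnd Z n g := by
    refine (SkewMonoidAlgebra.liftNC_single _ _ _ _).trans ?_
    simp
  rw [h]
  rfl

/-- `z ∈ Z` acts on `L_I` by multiplication. -/
theorem z_smul_apply {k : ℕ} [Fact (k < n)] (I : KSubset n k) (t z : Z) (v : L I Z)
    (i : ZMod n) :
    ((SkewMonoidAlgebra.single 1 (algebraMap Z (R n k t) z) : A 𝕜 n k t) • v : L I Z) i =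
      z * v i := by
  change (algEnd (𝕜 := 𝕜) I t (SkewMonoidAlgebra.single 1 (algebraMap Z _ z))) v i = _
  have h : algEnd (𝕜 := 𝕜) I t (SkewMonoidAlgebra.single 1 (algebraMap Z _ z)) =
      algebraMap Z _ z := by
    refine (SkewMonoidAlgebra.liftNC_single _ _ _ _).trans ?_
    rw [map_one, mul_one]
    exact (ringEnd I t).commutes z
  rw [h]
  rfl

end RankOne

/-! ### The `Ext` group and the non-crossing condition -/

/-- `Ext¹_A(L_I, L_J)`. -/
abbrev Ext1 (𝕜 : Type u) [Field 𝕜] {Z : Type u} [CommRing Z] [Algebra 𝕜 Z] {n k : ℕ}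
    [Fact (k < n)] (t : Z) (I J : KSubset n k) : Type u :=
  Abelian.Ext (ModuleCat.of (A 𝕜 n k t) (L I Z)) (ModuleCat.of (A 𝕜 n k t) (L J Z)) 1

/-- `a, b, c, d` are distinct and occur in this cyclic order: going around the circle `ℤ/n` from
`a` in the positive direction, one meets first `b`, then `c`, then `d`. -/
def CyclicallyOrdered {n : ℕ} (a b c d : ZMod n) : Prop :=
  0 < (b - a).val ∧ (b - a).val < (c - a).val ∧ (c - a).val < (d - a).val

/-- `I` and `J` are non-crossing (weakly separated): there are no cyclically ordered `a, b, c, d`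
with `a, c ∈ I \ J` and `b, d ∈ J \ I`. -/
def NonCrossing {n : ℕ} (I J : Finset (ZMod n)) : Prop :=
  ¬ ∃ a b c d : ZMod n, CyclicallyOrdered a b c d ∧
    a ∈ I \ J ∧ c ∈ I \ J ∧ b ∈ J \ I ∧ d ∈ J \ I

end JKS

end

/-! Compare `I` and `J` by a height `d` on `ℤ/n` that rises by one at `I \ J`, falls by one at `J \
I` and is otherwise constant (`exists_isHeight`). It closes up around the circle because `|I| =
|J|`. A map `L_I → L_J` sends each generator to a multiple of the generator at the same vertex, and
these multiples are proportional to `t ^ d` (`IsHeight.pow_mul_hom_gen`). Non-crossing means that,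
cyclically, all rises come before all falls. Vanishing of `Ext¹(L_I, L_J)` is used only as a lifting
property for maps out of `L_I` along surjections with kernel `L_J`.

If `I` and `J` are non-crossing, start from one lifted generator. A lift extends forwards over every
edge outside `J \ I` and backwards over every edge outside `I \ J`, since there an error in `L_J`
can be corrected through a map that is multiplication by `1` (`IsLift.step_up`, `IsLift.step_down`).
By `NonCrossing.exists_unimodal` a forward chain and a backward chain from the same vertex together
cover the circle. They agree where they meet: once around the circle `x ^ n = t ^ (n - k)` acts, so
the difference, which lies in `L_J`, is killed by a power of `t`, and `L_J` has no `t`-torsion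
(`NonCrossing.exists_lift`).

If they cross, some superlevel set `d ≥ m` is not an arc (`exists_two_peaks`). Take an arc whose end
points have height at least `m`, with points of height below `m` both inside and outside. Then `t ^
d` on the arc and zero elsewhere is a map `L_I → L_J / t ^ m` (`exists_hom_arc`). A lift to `L_J`
would be proportional to `t ^ d` everywhere; comparing the two low points would make `t` a unit
(`nonCrossing_of_subsingleton_ext`). -/

set_option linter.unusedSectionVars false

/-! ### Vanishing of `Ext¹` as a lifting property. -/

section ExtCriterion

variable {B X Y M Q : Type u} [Ring B] [AddCommGroup X] [Module B X] [AddCommGroup Y] [Module B Y]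
  [AddCommGroup M] [Module B M] [AddCommGroup Q] [Module B Q]

/-- If `Ext¹(X, Y) = 0`, maps from `X` lift along surjections with kernel `Y`. -/
theorem LinearMap.exists_lift_of_subsingleton_ext
    [Subsingleton (Abelian.Ext (ModuleCat.of B X) (ModuleCat.of B Y) 1)]
    (i : Y →ₗ[B] M) (q : M →ₗ[B] Q) (hi : Function.Injective i) (hiq : Function.Exact i q)
    (hq : Function.Surjective q) (f : X →ₗ[B] Q) : ∃ g : X →ₗ[B] M, q ∘ₗ g = f := by
  have hS : (ShortComplex.mk (ModuleCat.ofHom i) (ModuleCat.ofHom q)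
      (by rw [← ModuleCat.ofHom_comp, hiq.linearMap_comp_eq_zero]; rfl)).ShortExact :=
    { exact := by
        rw [ShortComplex.moduleCat_exact_iff]
        exact fun m hm => (hiq m).1 hm
      mono_f := (ModuleCat.mono_iff_injective _).2 hi
      epi_g := (ModuleCat.epi_iff_surjective _).2 hq }
  -- The connecting map sends `f` into `Ext¹(X, Y) = 0`, so `f` comes from `Hom(X, M)`.
  obtain ⟨x, hx⟩ := Abelian.Ext.covariant_sequence_exact₃ (ModuleCat.of B X) hS
    (Abelian.Ext.mk₀ (ModuleCat.ofHom f)) (zero_add 1) (Subsingleton.elim _ _)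
  obtain ⟨g, rfl⟩ := Abelian.Ext.addEquiv₀.symm.surjective x
  refine ⟨g.hom, ?_⟩
  have h : g ≫ ModuleCat.ofHom q = ModuleCat.ofHom f := by
    apply (Abelian.Ext.mk₀_bijective _ _).1
    rw [← Abelian.Ext.mk₀_comp_mk₀]
    exact hx
  exact congrArg ModuleCat.Hom.hom h

/-- If `Ext¹(X, Y) = 0`, maps from `X` to the cokernel of an injection `Y → M` lift to `M`. -/
theorem LinearMap.exists_cokernel_lift_of_subsingleton_ext
    [Subsingleton (Abelian.Ext (ModuleCat.of B X) (ModuleCat.of B Y) 1)]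
    (i : Y →ₗ[B] M) (hi : Function.Injective i) :
    ∃ (C : Type u) (_ : AddCommGroup C) (_ : Module B C) (q : M →ₗ[B] C),
      (∀ m, q m = 0 ↔ ∃ y, i y = m) ∧ ∀ f : X →ₗ[B] C, ∃ g : X →ₗ[B] M, ∀ x, q (g x) = f x := by
  refine ⟨M ⧸ LinearMap.range i, inferInstance, inferInstance, (LinearMap.range i).mkQ,
    fun m => Submodule.Quotient.mk_eq_zero _, fun f => ?_⟩
  obtain ⟨g, hg⟩ := LinearMap.exists_lift_of_subsingleton_ext i _ hi
    (LinearMap.exact_map_mkQ_range i) (Submodule.mkQ_surjective _) f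
  exact ⟨g, fun x => congrArg (fun h : X →ₗ[B] _ => h x) hg⟩

/-- If maps from `X` lift along all surjections with kernel `Y`, then `Ext¹(X, Y) = 0`. -/
theorem subsingleton_ext_of_exists_lift
    (h : ∀ (M Q : Type u) [AddCommGroup M] [Module B M] [AddCommGroup Q] [Module B Q]
      (i : Y →ₗ[B] M) (q : M →ₗ[B] Q), Function.Injective i → Function.Exact i q →
      Function.Surjective q → ∀ f : X →ₗ[B] Q, ∃ g : X →ₗ[B] M, q ∘ₗ g = f) :
    Subsingleton (Abelian.Ext (ModuleCat.of B X) (ModuleCat.of B Y) 1) := by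
  refine subsingleton_of_forall_eq 0 fun e => ?_
  -- Embed `Y` in an injective: every class in `Ext¹(X, Y)` is then the image of a map from `X` to
  -- the cokernel, and it vanishes once that map lifts.
  let S := ShortComplex.mk (Injective.ι (ModuleCat.of B Y)) (Limits.cokernel.π _)
    (Limits.cokernel.condition _)
  have hS : S.ShortExact := { exact := ShortComplex.exact_cokernel _ }
  obtain ⟨x, rfl⟩ := Abelian.Ext.covariant_sequence_exact₁ (ModuleCat.of B X) hS e
    (by
      have : Injective S.X₂ := inferInstanceAs (Injective (Injective.under _))
      exact Abelian.Ext.eq_zero_of_injective _) (zero_add 1)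
  obtain ⟨f, rfl⟩ := Abelian.Ext.addEquiv₀.symm.surjective x
  obtain ⟨g, hg⟩ := h S.X₂ S.X₃ S.f.hom S.g.hom
    ((ModuleCat.mono_iff_injective _).1 hS.mono_f)
    (ShortComplex.ShortExact.moduleCat_exact_iff_function_exact S |>.1 hS.exact)
    ((ModuleCat.epi_iff_surjective _).1 hS.epi_g) f.hom
  have hf : f = ModuleCat.ofHom g ≫ S.g := by
    ext1; exact hg.symm
  change (Abelian.Ext.mk₀ f).comp hS.extClass _ = 0
  rw [hf, ← Abelian.Ext.mk₀_comp_mk₀_assoc, ShortComplex.ShortExact.comp_extClass,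
    Abelian.Ext.comp_zero]

end ExtCriterion

noncomputable section

namespace JKS

/-! ### The twisted group ring: generators, relations, eigenspaces. -/

section Instances

variable {𝕜 : Type u} [Field 𝕜] {Z : Type u} [CommRing Z] [Algebra 𝕜 Z] {n k : ℕ}
  [Fact (k < n)] {t : Z}

/-! Shortcuts through the semiring structure, which make rewriting with general lemmas work. -/

instance (priority := 10000) instNonAssocSemiringA : NonAssocSemiring (A 𝕜 n k t) :=
  Semiring.toNonAssocSemiring (self := SkewMonoidAlgebra.instSemiring)

instance (priority := 10000) instMulA : Mul (A 𝕜 n k t) :=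
  NonUnitalNonAssocSemiring.toMul (self :=
    (instNonAssocSemiringA (𝕜 := 𝕜) (n := n) (k := k) (t := t)).toNonUnitalNonAssocSemiring)

instance (priority := 10000) instAddA : Add (A 𝕜 n k t) :=
  Distrib.toAdd (self := NonUnitalNonAssocSemiring.toDistrib (self :=
    (instNonAssocSemiringA (𝕜 := 𝕜) (n := n) (k := k) (t := t)).toNonUnitalNonAssocSemiring))

end Instances

section Generators

variable (𝕜 : Type u) [Field 𝕜] {Z : Type u} [CommRing Z] [Algebra 𝕜 Z] (n k : ℕ)
  [hkn : Fact (k < n)] (t : Z)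

/-- The element `x` of the twisted group ring. -/
def xA : A 𝕜 n k t := SkewMonoidAlgebra.single 1 (xR n k t)

/-- The element `y` of the twisted group ring. -/
def yA : A 𝕜 n k t := SkewMonoidAlgebra.single 1 (yR n k t)

/-- The scalars `Z` in the twisted group ring. -/
def zA : Z →+* A 𝕜 n k t :=
  (SkewMonoidAlgebra.singleOneRingHom (k := R n k t) (G := G 𝕜 n)).comp (algebraMap Z (R n k t))

/-- The group elements in the twisted group ring. -/
def gA (g : G 𝕜 n) : A 𝕜 n k t := SkewMonoidAlgebra.single g 1

variable {𝕜 n k t}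

theorem zA_apply (z : Z) :
    zA 𝕜 n k t z = SkewMonoidAlgebra.single 1 (algebraMap Z (R n k t) z) := rfl

theorem xR_mul_yR : xR n k t * yR n k t = algebraMap Z (R n k t) t := by
  refine Ideal.Quotient.eq.2 (Ideal.subset_span ?_)
  simp

theorem xR_pow_eq_yR_pow : xR n k t ^ k = yR n k t ^ (n - k) := by
  refine Ideal.Quotient.eq.2 (Ideal.subset_span ?_)
  simp

/-- Since `x ^ k = y ^ (n - k)`, the power `x ^ n` is `(x y) ^ (n - k)`; this is how that relation
enters the lifting argument. -/
theorem xR_pow_n : xR n k t ^ n = algebraMap Z (R n k t) (t ^ (n - k)) := by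
  have h : xR n k t ^ n = xR n k t ^ k * xR n k t ^ (n - k) := by
    rw [← pow_add, Nat.add_sub_cancel' hkn.out.le]
  rw [h, xR_pow_eq_yR_pow, ← mul_pow, mul_comm, xR_mul_yR, map_pow]

theorem single_one_mul (r s : R n k t) :
    (SkewMonoidAlgebra.single 1 r * SkewMonoidAlgebra.single 1 s : A 𝕜 n k t) =
      SkewMonoidAlgebra.single 1 (r * s) :=
  (map_mul (SkewMonoidAlgebra.singleOneRingHom (k := R n k t) (G := G 𝕜 n)) r s).symm

theorem xA_mul_yA : xA 𝕜 n k t * yA 𝕜 n k t = zA 𝕜 n k t t := by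
  rw [xA, yA, single_one_mul, xR_mul_yR, zA_apply]

theorem yA_mul_xA : yA 𝕜 n k t * xA 𝕜 n k t = zA 𝕜 n k t t := by
  rw [xA, yA, single_one_mul, mul_comm, xR_mul_yR, zA_apply]

theorem xA_pow_n : xA 𝕜 n k t ^ n = zA 𝕜 n k t (t ^ (n - k)) := by
  rw [zA_apply, ← xR_pow_n]
  exact (map_pow (SkewMonoidAlgebra.singleOneRingHom (k := R n k t) (G := G 𝕜 n)) _ _).symm

theorem zA_mul_xA (z : Z) : zA 𝕜 n k t z * xA 𝕜 n k t = xA 𝕜 n k t * zA 𝕜 n k t z := by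
  rw [zA_apply, xA, single_one_mul, single_one_mul, mul_comm]

theorem zA_mul_yA (z : Z) : zA 𝕜 n k t z * yA 𝕜 n k t = yA 𝕜 n k t * zA 𝕜 n k t z := by
  rw [zA_apply, yA, single_one_mul, single_one_mul, mul_comm]

theorem gA_mul_zA (g : G 𝕜 n) (z : Z) :
    gA 𝕜 n k t g * zA 𝕜 n k t z = zA 𝕜 n k t z * gA 𝕜 n k t g := by
  rw [zA_apply, gA, SkewMonoidAlgebra.single_mul_single, SkewMonoidAlgebra.single_mul_single,
    smul_algebraMap_R]
  simp

theorem gA_mul (g h : G 𝕜 n) : gA 𝕜 n k t (g * h) = gA 𝕜 n k t g * gA 𝕜 n k t h := by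
  rw [gA, gA, gA, SkewMonoidAlgebra.single_mul_single]
  simp

theorem gA_mul_xA (g : G 𝕜 n) : gA 𝕜 n k t g * xA 𝕜 n k t =
    zA 𝕜 n k t (algebraMap 𝕜 Z (g.unit : 𝕜)) * (xA 𝕜 n k t * gA 𝕜 n k t g) := by
  rw [← mul_assoc, zA_apply, gA, xA, single_one_mul, SkewMonoidAlgebra.single_mul_single,
    SkewMonoidAlgebra.single_mul_single, smul_xR]
  simp

theorem gA_mul_yA (g : G 𝕜 n) : gA 𝕜 n k t g * yA 𝕜 n k t =
    zA 𝕜 n k t (algebraMap 𝕜 Z ((g.unit⁻¹ : 𝕜ˣ) : 𝕜)) * (yA 𝕜 n k t * gA 𝕜 n k t g) := by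
  rw [← mul_assoc, zA_apply, gA, yA, single_one_mul, SkewMonoidAlgebra.single_mul_single,
    SkewMonoidAlgebra.single_mul_single, smul_yR]
  simp

variable {M N : Type*} [AddCommGroup M] [Module (A 𝕜 n k t) M] [AddCommGroup N]
  [Module (A 𝕜 n k t) N]

theorem zA_zero_smul (m : M) : zA 𝕜 n k t 0 • m = 0 := by
  rw [map_zero]; exact Module.zero_smul m

theorem zA_one_smul (m : M) : zA 𝕜 n k t 1 • m = m := by
  rw [map_one]; exact one_smul _ m

/-- An additive map commuting with the generators of the twisted group ring is linear. -/
theorem map_smul_of_generators (f : M →+ N)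
    (hx : ∀ m, f (xA 𝕜 n k t • m) = xA 𝕜 n k t • f m)
    (hy : ∀ m, f (yA 𝕜 n k t • m) = yA 𝕜 n k t • f m)
    (hz : ∀ z m, f (zA 𝕜 n k t z • m) = zA 𝕜 n k t z • f m)
    (hg : ∀ g m, f (gA 𝕜 n k t g • m) = gA 𝕜 n k t g • f m) (a : A 𝕜 n k t) (m : M) :
    f (a • m) = a • f m := by
  -- Induction on a polynomial representing `r`; `m` must vary because `hp` is applied to the
  -- variable times `m`.
  have hR (r : R n k t) (m : M) : f ((SkewMonoidAlgebra.single 1 r : A 𝕜 n k t) • m) =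
      (SkewMonoidAlgebra.single 1 r : A 𝕜 n k t) • f m := by
    obtain ⟨p, rfl⟩ := Ideal.Quotient.mk_surjective r
    induction p using MvPolynomial.induction_on generalizing m with
    | C z => exact hz z m
    | add p q hp hq =>
      rw [map_add, SkewMonoidAlgebra.single_add]
      refine (congrArg f (Module.add_smul _ _ m)).trans ?_
      rw [map_add, hp, hq]
      exact (Module.add_smul _ _ _).symm
    | mul_X p i hp =>
      rw [map_mul, ← single_one_mul, mul_smul, mul_smul, hp]
      congr 1
      fin_cases i
      · exact hx m
      · exact hy m
  induction a using SkewMonoidAlgebra.induction_on with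
  | zero =>
    change f ((0 : A 𝕜 n k t) • m) = (0 : A 𝕜 n k t) • f m
    rw [← map_zero (zA 𝕜 n k t), zA_zero_smul, zA_zero_smul, map_zero]
  | add a b ha hb =>
    change f ((a + b : A 𝕜 n k t) • m) = (a + b : A 𝕜 n k t) • f m
    rw [add_smul, add_smul, map_add, ha, hb]
  | single g r =>
    have h : (SkewMonoidAlgebra.single g r : A 𝕜 n k t) =
        SkewMonoidAlgebra.single 1 r * gA 𝕜 n k t g := by
      rw [gA, SkewMonoidAlgebra.single_mul_single, one_mul, one_smul, mul_one]
    rw [h, mul_smul, mul_smul, hR, hg]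

/-- `m` lies in the eigenspace `e_a M`. -/
def IsEigen (a : ZMod n) (m : M) : Prop :=
  ∀ g : G 𝕜 n, gA 𝕜 n k t g • m =
    zA 𝕜 n k t (algebraMap 𝕜 Z ((g.unit ^ a.val : 𝕜ˣ) : 𝕜)) • m

/-- Moving `g` past `x` costs a factor `g`, which raises the character by one; `g ^ n = 1` takes
care of the wrap-around of `val`. -/
theorem IsEigen.xA_smul [NeZero n] {a : ZMod n} {m : M} (h : IsEigen (𝕜 := 𝕜) (k := k) (t := t) (a - 1) m) :
    IsEigen (𝕜 := 𝕜) (k := k) (t := t) a (xA 𝕜 n k t • m) := by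
  intro g
  have hp := pow_val_succ g (a - 1)
  rw [sub_add_cancel] at hp
  rw [hp, ← mul_smul, gA_mul_xA, mul_smul, mul_smul, h g, ← mul_smul (xA _ _ _ _), ← zA_mul_xA,
    mul_smul, ← mul_smul, ← map_mul, ← map_mul, ← Units.val_mul]

theorem IsEigen.yA_smul [NeZero n] {a : ZMod n} {m : M} (h : IsEigen (𝕜 := 𝕜) (k := k) (t := t) a m) :
    IsEigen (𝕜 := 𝕜) (k := k) (t := t) (a - 1) (yA 𝕜 n k t • m) := by
  intro g
  have hp := pow_val_succ g (a - 1)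
  rw [sub_add_cancel] at hp
  rw [← mul_smul, gA_mul_yA, mul_smul, mul_smul, h g, ← mul_smul (yA _ _ _ _), ← zA_mul_yA,
    mul_smul, ← mul_smul, ← map_mul, ← map_mul, ← Units.val_mul, hp, inv_mul_cancel_left]

theorem IsEigen.zA_smul {a : ZMod n} {m : M} (h : IsEigen (𝕜 := 𝕜) (k := k) (t := t) a m) (z : Z) :
    IsEigen (𝕜 := 𝕜) (k := k) (t := t) a (zA 𝕜 n k t z • m) := by
  intro g
  rw [← mul_smul, gA_mul_zA, mul_smul, h g, ← mul_smul, ← mul_smul, ← map_mul, ← map_mul, mul_comm]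

theorem IsEigen.sub {a : ZMod n} {m m' : M} (h : IsEigen (𝕜 := 𝕜) (k := k) (t := t) a m)
    (h' : IsEigen (𝕜 := 𝕜) (k := k) (t := t) a m') :
    IsEigen (𝕜 := 𝕜) (k := k) (t := t) a (m - m') := by
  intro g
  rw [smul_sub, h g, h' g, smul_sub]

theorem IsEigen.map {a : ZMod n} {m : M} (h : IsEigen (𝕜 := 𝕜) (k := k) (t := t) a m)
    (f : M →ₗ[A 𝕜 n k t] N) : IsEigen (𝕜 := 𝕜) (k := k) (t := t) a (f m) := by
  intro g
  rw [← map_smul, h g, map_smul]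

theorem IsEigen.of_map {a : ZMod n} {m : M} (f : M →ₗ[A 𝕜 n k t] N) (hf : Function.Injective f)
    (h : IsEigen (𝕜 := 𝕜) (k := k) (t := t) a (f m)) :
    IsEigen (𝕜 := 𝕜) (k := k) (t := t) a m := by
  intro g
  apply hf
  rw [map_smul, h g, map_smul]

/-- Averaging over `G` projects onto the eigenspace `e_a M`, so eigenvectors lift along surjections. -/
theorem IsEigen.exists_lift [NeZero n] {ζ : 𝕜} (hζ : IsPrimitiveRoot ζ n) (f : M →ₗ[A 𝕜 n k t] N)
    (hf : Function.Surjective f) {a : ZMod n} {m : N}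
    (h : IsEigen (𝕜 := 𝕜) (k := k) (t := t) a m) :
    ∃ m' : M, IsEigen (𝕜 := 𝕜) (k := k) (t := t) a m' ∧ f m' = m := by
  obtain ⟨m₀, rfl⟩ := hf m
  have : Finite (G 𝕜 n) := inferInstanceAs (Finite (rootsOfUnity n 𝕜))
  let _ : Fintype (G 𝕜 n) := Fintype.ofFinite _
  have hcard : Fintype.card (G 𝕜 n) = n := by
    rw [← Nat.card_eq_fintype_card]; exact hζ.card_rootsOfUnity
  -- A primitive `n`-th root of unity forces `n` to be invertible in `𝕜`.
  have hn : (n : 𝕜) ≠ 0 := hζ.neZero'.out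
  let c (g : G 𝕜 n) : A 𝕜 n k t :=
    zA 𝕜 n k t (algebraMap 𝕜 Z (((g.unit ^ a.val)⁻¹ : 𝕜ˣ) : 𝕜))
  refine ⟨zA 𝕜 n k t (algebraMap 𝕜 Z (n : 𝕜)⁻¹) • ∑ g : G 𝕜 n, c g • gA 𝕜 n k t g • m₀,
    IsEigen.zA_smul ?_ _, ?_⟩
  · intro g
    rw [Finset.smul_sum, Finset.smul_sum]
    refine Fintype.sum_equiv (Equiv.mulLeft g) _ _ fun h => ?_
    simp only [c, Equiv.coe_mulLeft]
    rw [← mul_smul, gA_mul_zA, mul_smul, ← mul_smul (gA _ _ _ _ _), ← gA_mul,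
      ← mul_smul (zA _ _ _ _ _) (zA _ _ _ _ _), ← map_mul, ← map_mul, ← Units.val_mul, G.unit_mul, mul_pow, mul_inv, mul_inv_cancel_left]
  · rw [map_smul, map_sum]
    have h1 (g : G 𝕜 n) : f (c g • gA 𝕜 n k t g • m₀) = f m₀ := by
      rw [map_smul, map_smul, h g, ← mul_smul, ← map_mul, ← map_mul, ← Units.val_mul,
        inv_mul_cancel, Units.val_one, map_one, zA_one_smul]
    simp only [h1, Finset.sum_const, Finset.card_univ, hcard]
    rw [← Nat.cast_smul_eq_nsmul (A 𝕜 n k t), ← map_natCast (zA 𝕜 n k t), ← map_natCast (algebraMap 𝕜 Z),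
      ← mul_smul, ← map_mul, ← map_mul, inv_mul_cancel₀ hn, map_one, zA_one_smul]

end Generators

/-! ### The rank one modules by generators and relations. -/

section RankOne

variable {𝕜 : Type u} [Field 𝕜] {Z : Type u} [CommRing Z] [Algebra 𝕜 Z] {n k : ℕ}
  [Fact (k < n)] {t : Z} {M : Type*} [AddCommGroup M] [Module (A 𝕜 n k t) M] (I : KSubset n k)

/-- The generator of `e_a L_I = Z`. -/
def gen (Z : Type u) [CommRing Z] (a : ZMod n) : L I Z := (Pi.single a 1 : ZMod n → Z)

variable {I}

theorem xA_smul_apply (v : L I Z) (i : ZMod n) :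
    (xA 𝕜 n k t • v : L I Z) i = xCoeff I.1 t i * v (i - 1) := x_smul_apply I t v i

theorem yA_smul_apply (v : L I Z) (i : ZMod n) :
    (yA 𝕜 n k t • v : L I Z) i = yCoeff I.1 t (i + 1) * v (i + 1) := y_smul_apply I t v i

theorem zA_smul_apply (z : Z) (v : L I Z) (i : ZMod n) :
    (zA 𝕜 n k t z • v : L I Z) i = z * v i := z_smul_apply I t z v i

theorem gA_smul_apply (g : G 𝕜 n) (v : L I Z) (i : ZMod n) :
    (gA 𝕜 n k t g • v : L I Z) i = algebraMap 𝕜 Z ((g.unit ^ i.val : 𝕜ˣ) : 𝕜) * v i :=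
  g_smul_apply I t g v i

theorem L_ext {v w : L I Z} (h : ∀ i, v i = w i) : v = w := funext h

theorem gen_apply (a i : ZMod n) : gen I Z a i = if i = a then 1 else 0 :=
  Pi.single_apply a (1 : Z) i

theorem gen_self (a : ZMod n) : gen I Z a a = 1 := by simp [gen_apply]

theorem isEigen_gen (a : ZMod n) : IsEigen (𝕜 := 𝕜) (k := k) (t := t) a (gen I Z a) := by
  intro g
  apply L_ext
  intro i
  rw [gA_smul_apply, zA_smul_apply, gen_apply]
  split_ifs with h
  · rw [h]
  · simp

theorem xA_smul_gen (a : ZMod n) :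
    xA 𝕜 n k t • gen I Z (a - 1) = zA 𝕜 n k t (xCoeff I.1 t a) • gen I Z a := by
  apply L_ext
  intro i
  rw [xA_smul_apply, zA_smul_apply, gen_apply, gen_apply]
  simp only [sub_left_inj]
  split_ifs with h
  · rw [h]
  · simp

theorem yA_smul_gen (a : ZMod n) :
    yA 𝕜 n k t • gen I Z a = zA 𝕜 n k t (yCoeff I.1 t a) • gen I Z (a - 1) := by
  apply L_ext
  intro i
  rw [yA_smul_apply, zA_smul_apply, gen_apply, gen_apply]
  simp only [eq_sub_iff_add_eq]
  split_ifs with h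
  · rw [h]
  · simp

theorem eq_sum_gen [NeZero n] (v : L I Z) : v = ∑ a, zA 𝕜 n k t (v a) • gen I Z a := by
  apply L_ext
  intro i
  have h (s : Finset (ZMod n)) (w : ZMod n → L I Z) : (∑ a ∈ s, w a) i = ∑ a ∈ s, w a i :=
    Finset.sum_apply (M := fun _ => Z) i s w
  rw [h]
  simp only [zA_smul_apply, gen_apply, mul_ite, mul_one, mul_zero]
  exact (Fintype.sum_ite_eq i _).symm

/-- A family of vectors satisfying the relations of the generators defines a map out of `L_I`. -/
theorem exists_hom_gen [NeZero n] (s : ZMod n → M)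
    (hs : ∀ a, IsEigen (𝕜 := 𝕜) (k := k) (t := t) a (s a))
    (hx : ∀ a, xA 𝕜 n k t • s (a - 1) = zA 𝕜 n k t (xCoeff I.1 t a) • s a)
    (hy : ∀ a, yA 𝕜 n k t • s a = zA 𝕜 n k t (yCoeff I.1 t a) • s (a - 1)) :
    ∃ f : L I Z →ₗ[A 𝕜 n k t] M, ∀ a, f (gen I Z a) = s a := by
  let f : L I Z →+ M :=
    { toFun := fun v => ∑ a, zA 𝕜 n k t (v a) • s a
      map_zero' := by
        have h (a : ZMod n) : (0 : L I Z) a = 0 := rfl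
        simp only [h, zA_zero_smul, Finset.sum_const_zero]
      map_add' := fun v w => by
        have h (a : ZMod n) : (v + w) a = v a + w a := rfl
        simp only [h, map_add, add_smul, Finset.sum_add_distrib] }
  have hf (v : L I Z) : f v = ∑ a, zA 𝕜 n k t (v a) • s a := rfl
  refine ⟨{ f with map_smul' := map_smul_of_generators f ?_ ?_ ?_ ?_ }, fun a => ?_⟩
  · intro v
    rw [hf, hf, Finset.smul_sum]
    refine Fintype.sum_equiv (Equiv.subRight 1) _ _ fun a => ?_
    rw [Equiv.subRight_apply, xA_smul_apply, mul_comm, map_mul, mul_smul, ← hx, ← mul_smul,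
      zA_mul_xA, mul_smul]
  · intro v
    rw [hf, hf, Finset.smul_sum]
    refine Fintype.sum_equiv (Equiv.addRight 1) _ _ fun a => ?_
    have h := hy (a + 1)
    rw [add_sub_cancel_right] at h
    rw [Equiv.coe_addRight, yA_smul_apply, mul_comm, map_mul, mul_smul, ← h, ← mul_smul,
      zA_mul_yA, mul_smul]
  · intro z v
    rw [hf, hf, Finset.smul_sum]
    refine Finset.sum_congr rfl fun a _ => ?_
    rw [zA_smul_apply, map_mul, mul_smul]
  · intro g v
    rw [hf, hf, Finset.smul_sum]
    refine Finset.sum_congr rfl fun a _ => ?_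
    rw [gA_smul_apply, mul_comm, map_mul, mul_smul, ← hs a g, ← mul_smul, ← gA_mul_zA, mul_smul]
  · change ∑ b, zA 𝕜 n k t (gen I Z a b) • s b = s a
    rw [Finset.sum_eq_single a]
    · rw [gen_self, zA_one_smul]
    · intro b _ hb
      rw [gen_apply, if_neg hb, zA_zero_smul]
    · simp

theorem hom_ext_gen [NeZero n] {f g : L I Z →ₗ[A 𝕜 n k t] M}
    (h : ∀ a, f (gen I Z a) = g (gen I Z a)) : f = g := by
  ext v
  rw [eq_sum_gen (𝕜 := 𝕜) (k := k) (t := t) v, map_sum, map_sum]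
  simp only [map_smul, h]

/-- The eigenspace `e_a L_I` is generated by `gen I Z a`. -/
theorem IsEigen.eq_smul_gen [NeZero n] {ζ : 𝕜} (hζ : IsPrimitiveRoot ζ n) {a : ZMod n} {v : L I Z}
    (h : IsEigen (𝕜 := 𝕜) (k := k) (t := t) a v) : v = zA 𝕜 n k t (v a) • gen I Z a := by
  -- A primitive root separates the characters: the coordinate at `i ≠ a` is killed by `ζ ^ i - ζ ^
  -- a`, a unit of `𝕜`.
  let g : G 𝕜 n := hζ.toRootsOfUnity
  have hg : (g.unit : 𝕜) = ζ := rfl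
  apply L_ext
  intro i
  rw [zA_smul_apply, gen_apply]
  split_ifs with hi
  · rw [hi, mul_one]
  · have h1 := congrFun (h g) i
    change (gA 𝕜 n k t g • v : L I Z) i = (zA 𝕜 n k t _ • v : L I Z) i at h1
    rw [gA_smul_apply, zA_smul_apply, ← sub_eq_zero, ← sub_mul, ← map_sub] at h1
    have h2 : (((g.unit ^ i.val : 𝕜ˣ) : 𝕜) - ((g.unit ^ a.val : 𝕜ˣ) : 𝕜)) ≠ 0 := by
      rw [sub_ne_zero, Units.val_pow_eq_pow_val, Units.val_pow_eq_pow_val, hg]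
      intro h3
      exact hi (ZMod.val_injective n (hζ.pow_inj (ZMod.val_lt i) (ZMod.val_lt a) h3))
    rw [mul_zero]
    exact ((IsUnit.mk0 _ h2).map (algebraMap 𝕜 Z)).mul_right_eq_zero.1 h1

end RankOne

end JKS
end

namespace JKS

/-! ### Height functions and the combinatorics of crossing. -/

section Heights

variable {n : ℕ} [NeZero n]

theorem val_add_one_cases (a : ZMod n) :
    ((a + 1).val = a.val + 1 ∧ a.val + 1 < n) ∨ ((a + 1).val = 0 ∧ a.val + 1 = n) := by
  have h := ZMod.val_lt a
  have h1 : (a + 1).val = (a.val + 1) % n := by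
    rw [← ZMod.val_natCast, Nat.cast_add, ZMod.natCast_zmod_val, Nat.cast_one]
  rcases Nat.lt_or_ge (a.val + 1) n with h2 | h2
  · exact Or.inl ⟨by rw [h1, Nat.mod_eq_of_lt h2], h2⟩
  · have h3 : a.val + 1 = n := by omega
    exact Or.inr ⟨by rw [h1, h3, Nat.mod_self], h3⟩

/-- Reduces cyclic order to linear arithmetic on representatives. -/
theorem val_sub_cases (a b : ZMod n) :
    (b.val ≤ a.val ∧ (a - b).val = a.val - b.val) ∨
      (a.val < b.val ∧ (a - b).val + b.val = a.val + n) := by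
  have ha := ZMod.val_lt a
  have hb := ZMod.val_lt b
  rcases Nat.lt_or_ge a.val b.val with h | h
  · refine Or.inr ⟨h, ?_⟩
    have h1 : a - b = ((a.val + n - b.val : ℕ) : ZMod n) := by
      rw [Nat.cast_sub (by omega)]; simp
    rw [h1, ZMod.val_natCast, Nat.mod_eq_of_lt (by omega)]
    omega
  · exact Or.inl ⟨h, ZMod.val_sub h⟩

theorem val_add_natCast_sub (v : ZMod n) {i j : ℕ} (hij : i ≤ j) (hj : j < n) :
    (v + j + 1 - (v + i + 1)).val = j - i := by
  have h : v + j + 1 - (v + i + 1) = ((j - i : ℕ) : ZMod n) := by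
    rw [Nat.cast_sub hij]; ring
  rw [h, ZMod.val_natCast, Nat.mod_eq_of_lt (by omega)]

/-- A function on `ℤ/n` which increases by one at the elements of `I \ J` and decreases by one at
the elements of `J \ I`. -/
def IsHeight (I J : Finset (ZMod n)) (d : ZMod n → ℕ) : Prop :=
  ∀ a, d a + (if a ∈ J then 1 else 0) = d (a - 1) + (if a ∈ I then 1 else 0)

/-- The partial sums of `[a ∈ I] - [a ∈ J]` have total `k - k = 0`, so they descend to `ℤ/n`. -/
theorem exists_isHeight {k : ℕ} (I J : KSubset n k) : ∃ d, IsHeight I.1 J.1 d := by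
  let w (a : ZMod n) : ℤ := (if a ∈ I.1 then 1 else 0) - (if a ∈ J.1 then 1 else 0)
  let S (r : ℕ) : ℤ := ∑ i ∈ Finset.range r, w (i + 1)
  let e (a : ZMod n) : ℤ := S a.val
  have hS : S n = 0 := by
    have h1 : S n = ∑ a : ZMod n, w (a + 1) :=
      Finset.sum_nbij' (fun i => (i : ZMod n)) ZMod.val (by simp)
        (fun a _ => Finset.mem_range.2 (ZMod.val_lt a))
        (fun i hi => by rw [ZMod.val_natCast, Nat.mod_eq_of_lt (Finset.mem_range.1 hi)])
        (by simp) (by simp)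
    have h2 : ∑ a : ZMod n, w (a + 1) = ∑ a, w a := Equiv.sum_comp (Equiv.addRight 1) w
    rw [h1, h2]
    simp [w, Finset.sum_sub_distrib, I.2, J.2]
  have he (a : ZMod n) : e (a + 1) = e a + w (a + 1) := by
    have h1 : S (a.val + 1) = S a.val + w (a + 1) := by
      simp only [S, Finset.sum_range_succ, ZMod.natCast_zmod_val]
    rcases val_add_one_cases a with ⟨h, _⟩ | ⟨h, h'⟩
    · simp only [e, h, h1]
    · simp only [e]
      rw [h, ← h1, h', hS]
      simp [S]
  -- Subtracting a lower bound makes the values natural numbers, so that `t ^ d` makes sense.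
  obtain ⟨c, hc⟩ := (Set.finite_range e).bddBelow
  have hc' (a) : c ≤ e a := hc ⟨a, rfl⟩
  refine ⟨fun a => (e a - c).toNat, fun a => ?_⟩
  have h1 := he (a - 1)
  rw [sub_add_cancel] at h1
  have h2 := hc' a
  have h3 := hc' (a - 1)
  simp only [w] at h1
  dsimp only
  split_ifs at h1 ⊢ <;> omega

variable {I J : Finset (ZMod n)} {d : ZMod n → ℕ}

theorem IsHeight.step (hd : IsHeight I J d) (v : ZMod n) (j : ℕ) :
    d (v + (j + 1 : ℕ)) + (if v + j + 1 ∈ J then 1 else 0) =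
      d (v + j) + (if v + j + 1 ∈ I then 1 else 0) := by
  have h := hd (v + j + 1)
  rw [add_sub_cancel_right] at h
  rwa [Nat.cast_add, Nat.cast_one, ← add_assoc]

/-- A path that ends higher than it began has a rising step; step `l` crosses from `v + l` to `v + l
+ 1`. -/
theorem IsHeight.exists_up (hd : IsHeight I J d) (v : ZMod n) {i j : ℕ} (hij : i ≤ j)
    (h : d (v + i) < d (v + j)) : ∃ l, i ≤ l ∧ l < j ∧ v + l + 1 ∈ I \ J := by
  induction j, hij using Nat.le_induction with
  | base => omega
  | succ j hij ih =>
    by_cases hj : v + j + 1 ∈ I \ J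
    · exact ⟨j, hij, by omega, hj⟩
    · have h1 := hd.step v j
      have h2 : d (v + i) < d (v + j) := by
        rw [Finset.mem_sdiff] at hj
        split_ifs at h1 <;> first | omega | tauto
      obtain ⟨l, h3, h4, h5⟩ := ih h2
      exact ⟨l, h3, by omega, h5⟩

/-- Turning the height upside down exchanges `I` and `J`. The sum of all heights bounds each one, so
no subtraction truncates. -/
theorem IsHeight.exists_down (hd : IsHeight I J d) (v : ZMod n) {i j : ℕ} (hij : i ≤ j)
    (h : d (v + j) < d (v + i)) : ∃ l, i ≤ l ∧ l < j ∧ v + l + 1 ∈ J \ I :=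
  IsHeight.exists_up (I := J) (J := I) (d := fun a => ∑ b, d b - d a)
    (fun a => by
      have h1 := hd a
      have h2 := Finset.single_le_sum (f := d) (fun _ _ => Nat.zero_le _) (Finset.mem_univ a)
      have h3 := Finset.single_le_sum (f := d) (fun _ _ => Nat.zero_le _) (Finset.mem_univ (a - 1))
      dsimp only
      omega) v hij (by
      have h2 := Finset.single_le_sum (f := d) (fun _ _ => Nat.zero_le _)
        (Finset.mem_univ (v + i))
      omega)

/-- For non-crossing sets the height first increases and then decreases around the circle. -/
theorem NonCrossing.exists_unimodal (h : NonCrossing I J) (hd : IsHeight I J d) :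
    ∃ (v : ZMod n) (m : ℕ), m ≤ n ∧ (∀ j < m, v + j + 1 ∉ J \ I) ∧
      ∀ j, m ≤ j → j < n → v + j + 1 ∉ I \ J := by
  -- Start at a lowest vertex and let the cut be just after the last rise.
  obtain ⟨v, hv⟩ := Finite.exists_min d
  let S := (Finset.range n).filter fun j : ℕ => v + j + 1 ∈ I \ J
  by_cases hS : S.Nonempty
  · obtain ⟨m, hm, hmax⟩ : ∃ m ∈ S, ∀ j ∈ S, j ≤ m :=
      ⟨S.max' hS, S.max'_mem hS, fun j hj => S.le_max' j hj⟩
    obtain ⟨hm1, hm2⟩ := Finset.mem_filter.1 hm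
    rw [Finset.mem_range] at hm1
    refine ⟨v, m + 1, hm1, fun j hj hj2 => h ?_, fun j hj hjn hj2 => ?_⟩
    · have hjm : j < m := by
        rcases Nat.lt_or_ge j m with h1 | h1
        · exact h1
        · obtain rfl : j = m := by omega
          rw [Finset.mem_sdiff] at hm2 hj2
          exact absurd hm2.1 hj2.2
      have e1 := hd.step v j
      have e2 := hd.step v m
      have hj3 := Finset.mem_sdiff.1 hj2
      have hm3 := Finset.mem_sdiff.1 hm2
      rw [if_pos hj3.1, if_neg hj3.2] at e1
      rw [if_pos hm3.1, if_neg hm3.2] at e2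
      have m1 := hv (v + (j + 1 : ℕ))
      have m2 := hv (v + m)
      -- A fall `j` before the last rise `m` needs a rise `i` before it, as no vertex is below `v`;
      -- after `m` the height must fall back to `d v`. So `i < j < m < l` is a crossing.
      obtain ⟨i, -, hij, hi⟩ := hd.exists_up v (i := 0) (j := j) (Nat.zero_le _)
        (by rw [Nat.cast_zero, add_zero]; omega)
      obtain ⟨l, hml, hln, hl⟩ := hd.exists_down v (i := m + 1) (j := n) (by omega)
        (by rw [ZMod.natCast_self, add_zero]; omega)
      refine ⟨v + i + 1, v + j + 1, v + m + 1, v + l + 1, ⟨?_, ?_, ?_⟩, hi, hm2, hj2, hl⟩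
      · rw [val_add_natCast_sub v hij.le (by omega)]; omega
      · rw [val_add_natCast_sub v hij.le (by omega), val_add_natCast_sub v (by omega) (by omega)]
        omega
      · rw [val_add_natCast_sub v (by omega) (by omega), val_add_natCast_sub v (by omega) hln]
        omega
    · have := hmax j (Finset.mem_filter.2 ⟨Finset.mem_range.2 hjn, hj2⟩)
      omega
  · refine ⟨v, 0, Nat.zero_le _, by simp, fun j _ hj hj2 => hS ⟨j, ?_⟩⟩
    exact Finset.mem_filter.2 ⟨Finset.mem_range.2 hj, hj2⟩

/-- For crossing sets some superlevel set of the height is not an interval. -/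
theorem exists_two_peaks (h : ¬ NonCrossing I J) (hd : IsHeight I J d) :
    ∃ (p q v₁ v₂ : ZMod n) (m : ℕ), (v₁ - p).val ≤ (q - p).val ∧ (q - p).val < (v₂ - p).val ∧
      m ≤ d p ∧ m ≤ d q ∧ d v₁ < m ∧ d v₂ < m := by
  obtain ⟨a, b, c, e, ⟨h1, h2, h3⟩, ha, hc, hb, he⟩ := not_not.1 h
  -- Seen from a highest vertex `p`, some rise `x` precedes some fall `y`: otherwise all of `b, e`
  -- come before all of `a, c`, against the cyclic order.
  obtain ⟨p, hp⟩ := Finite.exists_max d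
  have key : ∃ x y : ZMod n, x ∈ I \ J ∧ y ∈ J \ I ∧ (x - 1 - p).val < (y - 1 - p).val := by
    by_contra! hcon
    have k1 := hcon a b ha hb
    have k2 := hcon a e ha he
    have k3 := hcon c b hc hb
    have k4 := hcon c e hc he
    have e1 : b - a = b - 1 - p - (a - 1 - p) := by ring
    have e2 : c - a = c - 1 - p - (a - 1 - p) := by ring
    have e3 : e - a = e - 1 - p - (a - 1 - p) := by ring
    rw [e1] at h1 h2
    rw [e2] at h2 h3
    rw [e3] at h3
    have c1 := val_sub_cases (b - 1 - p) (a - 1 - p)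
    have c2 := val_sub_cases (c - 1 - p) (a - 1 - p)
    have c3 := val_sub_cases (e - 1 - p) (a - 1 - p)
    have l1 := ZMod.val_lt (a - 1 - p)
    have l2 := ZMod.val_lt (b - 1 - p)
    have l3 := ZMod.val_lt (c - 1 - p)
    have l4 := ZMod.val_lt (e - 1 - p)
    omega
  obtain ⟨x, y, hx, hy, hxy⟩ := key
  have hyn := ZMod.val_lt (y - 1 - p)
  have ex : p + ((x - 1 - p).val : ZMod n) + 1 = x := by rw [ZMod.natCast_zmod_val]; ring
  have ey : p + ((y - 1 - p).val : ZMod n) + 1 = y := by rw [ZMod.natCast_zmod_val]; ring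
  generalize (x - 1 - p).val = i at *
  generalize (y - 1 - p).val = j at *
  have e1 := hd.step p i
  have e2 := hd.step p j
  rw [ex] at e1
  rw [ey] at e2
  rw [Finset.mem_sdiff] at hx hy
  rw [if_pos hx.1, if_neg hx.2] at e1
  rw [if_pos hy.1, if_neg hy.2] at e2
  -- The second peak is a highest vertex between the rise and the fall; the low vertices are those
  -- just before the rise and just after the fall, and `m = d q`.
  obtain ⟨q, hq, hqmax⟩ := Finset.exists_max_image (Finset.Icc (i + 1) j)
    (fun l : ℕ => d (p + l)) ⟨j, Finset.mem_Icc.2 ⟨hxy, le_rfl⟩⟩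
  rw [Finset.mem_Icc] at hq
  have q1 := hqmax (i + 1) (Finset.mem_Icc.2 ⟨le_rfl, hxy⟩)
  have q2 := hqmax j (Finset.mem_Icc.2 ⟨hxy, le_rfl⟩)
  have hval {l : ℕ} (hl : l < n) : (p + l - p).val = l := by
    rw [add_sub_cancel_left, ZMod.val_natCast, Nat.mod_eq_of_lt hl]
  -- The vertex after the fall is not `p` itself, since `p` is highest.
  have hj : j + 1 < n := by
    rcases Nat.lt_or_ge (j + 1) n with hj | hj
    · exact hj
    · have hjn : j + 1 = n := by omega
      rw [hjn, ZMod.natCast_self, add_zero] at e2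
      have := hp (p + q)
      omega
  refine ⟨p, p + q, p + i, p + (j + 1 : ℕ), d (p + q), ?_, ?_, hp _, le_rfl, by omega, by omega⟩
  · rw [hval (by omega), hval (by omega)]; omega
  · rw [hval (by omega), hval hj]; omega

end Heights

end JKS

noncomputable section

namespace JKS

/-- Finite dependent choice: `P` is the invariant at each vertex, `E` the relation along each edge.
-/
theorem exists_chain {M : Type*} (m : ℕ) (P : ℕ → M → Prop) (E : ℕ → M → M → Prop) {x₀ : M}
    (h₀ : P 0 x₀) (step : ∀ j < m, ∀ x, P j x → ∃ y, P (j + 1) y ∧ E j x y) :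
    ∃ s : ℕ → M, s 0 = x₀ ∧ (∀ j ≤ m, P j (s j)) ∧ ∀ j < m, E j (s j) (s (j + 1)) := by
  induction m with
  | zero =>
    refine ⟨fun _ => x₀, rfl, fun j hj => ?_, by simp⟩
    obtain rfl : j = 0 := by omega
    exact h₀
  | succ m ih =>
    obtain ⟨s, hs0, hsP, hsE⟩ := ih fun j hj => step j (by omega)
    obtain ⟨y, hy, hy'⟩ := step m (by omega) _ (hsP m le_rfl)
    refine ⟨fun j => if j ≤ m then s j else y, by simpa using hs0, fun j hj => ?_, fun j hj => ?_⟩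
    · by_cases h : j ≤ m
      · simpa [h] using hsP j h
      · obtain rfl : j = m + 1 := by omega
        simpa using hy
    · by_cases h : j + 1 ≤ m
      · have h' : j ≤ m := by omega
        simpa [h, h'] using hsE j h
      · obtain rfl : j = m := by omega
        simpa using hy'

/-! ### Lifting around the circle when `I` and `J` are non-crossing. -/

section Edge

variable {𝕜 : Type u} [Field 𝕜] {Z : Type u} [CommRing Z] [Algebra 𝕜 Z] {n k : ℕ}
  [Fact (k < n)] [NeZero n] {t : Z} {M Q : Type u} [AddCommGroup M] [Module (A 𝕜 n k t) M]
  [AddCommGroup Q] [Module (A 𝕜 n k t) Q] {I J : KSubset n k}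

variable (𝕜 t) in
/-- The relations between the images of the generators at the vertices `a - 1` and `a` under a map
out of `L_I`. -/
def Edge (I : KSubset n k) (a : ZMod n) (m m' : M) : Prop :=
  xA 𝕜 n k t • m = zA 𝕜 n k t (xCoeff I.1 t a) • m' ∧
    yA 𝕜 n k t • m' = zA 𝕜 n k t (yCoeff I.1 t a) • m

theorem xA_zA_smul (z : Z) (m : M) :
    xA 𝕜 n k t • zA 𝕜 n k t z • m = zA 𝕜 n k t z • xA 𝕜 n k t • m := by
  rw [← mul_smul, ← zA_mul_xA, mul_smul]

theorem yA_zA_smul (z : Z) (m : M) :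
    yA 𝕜 n k t • zA 𝕜 n k t z • m = zA 𝕜 n k t z • yA 𝕜 n k t • m := by
  rw [← mul_smul, ← zA_mul_yA, mul_smul]

theorem zA_zA_smul (z w : Z) (m : M) :
    zA 𝕜 n k t z • zA 𝕜 n k t w • m = zA 𝕜 n k t (z * w) • m := by
  rw [← mul_smul, ← map_mul]

theorem xA_yA_smul (m : M) : xA 𝕜 n k t • yA 𝕜 n k t • m = zA 𝕜 n k t t • m := by
  rw [← mul_smul, xA_mul_yA]

theorem yA_xA_smul (m : M) : yA 𝕜 n k t • xA 𝕜 n k t • m = zA 𝕜 n k t t • m := by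
  rw [← mul_smul, yA_mul_xA]

/-- One relation suffices where `x` acts on `L_I` by `1`: the other follows from `y x = t`. -/
theorem edge_of_mem {a : ZMod n} (ha : a ∈ I.1) {m m' : M} (h : xA 𝕜 n k t • m = m') :
    Edge 𝕜 t I a m m' := by
  refine ⟨?_, ?_⟩
  · rw [xCoeff, if_pos ha, zA_one_smul, h]
  · rw [yCoeff, if_pos ha, ← h, yA_xA_smul]

theorem edge_of_notMem {a : ZMod n} (ha : a ∉ I.1) {m m' : M} (h : yA 𝕜 n k t • m' = m) :
    Edge 𝕜 t I a m m' := by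
  refine ⟨?_, ?_⟩
  · rw [xCoeff, if_neg ha, ← h, xA_yA_smul]
  · rw [yCoeff, if_neg ha, zA_one_smul, h]

theorem xA_pow_smul_chain (m : ℕ) (s : ℕ → M) (c : ℕ → Z)
    (h : ∀ j < m, xA 𝕜 n k t • s j = zA 𝕜 n k t (c j) • s (j + 1)) :
    xA 𝕜 n k t ^ m • s 0 = zA 𝕜 n k t (∏ j ∈ Finset.range m, c j) • s m := by
  induction m with
  | zero => rw [Finset.prod_range_zero, zA_one_smul, pow_zero]; exact one_smul _ _
  | succ m ih =>
    rw [pow_succ', mul_smul, ih fun j hj => h j (by omega), xA_zA_smul, h m (by omega),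
      zA_zA_smul, Finset.prod_range_succ]

variable {i : L J Z →ₗ[A 𝕜 n k t] M} {q : M →ₗ[A 𝕜 n k t] Q} {f : L I Z →ₗ[A 𝕜 n k t] Q}

variable (q f) in
/-- `m ∈ e_a M` lifts the image of the generator at `a`. -/
def IsLift (a : ZMod n) (m : M) : Prop :=
  IsEigen (𝕜 := 𝕜) (k := k) (t := t) a m ∧ q m = f (gen I Z a)

section

variable {ζ : 𝕜} (hζ : IsPrimitiveRoot ζ n) (hi : Function.Injective i)
  (hiq : Function.Exact i q)

include hζ hi hiq

/-- Measures the error of a lift: an eigenvector in the kernel comes from `e_a L_J`, which is free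
of rank one. -/
theorem exists_eq_smul_gen {a : ZMod n} {m : M} (hm : IsEigen (𝕜 := 𝕜) (k := k) (t := t) a m)
    (h : q m = 0) : ∃ z, m = i (zA 𝕜 n k t z • gen J Z a) := by
  obtain ⟨v, rfl⟩ := (hiq m).1 h
  exact ⟨v a, congrArg i (IsEigen.eq_smul_gen hζ (IsEigen.of_map i hi hm))⟩

variable (hq : Function.Surjective q)

include hq

/-- For `a ∈ I` the next lift is forced to be `x m`. For `a ∉ I ∪ J` any lift at `a` can be
corrected, because `y : e_a L_J → e_{a-1} L_J` is multiplication by `1`. On `J \ I` that map is `t`,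
whence the exclusion. -/
theorem IsLift.step_up {a : ZMod n} (ha : a ∉ J.1 \ I.1) {m : M} (hm : IsLift q f (a - 1) m) :
    ∃ m', IsLift q f a m' ∧ Edge 𝕜 t I a m m' := by
  by_cases haI : a ∈ I.1
  · refine ⟨_, ⟨hm.1.xA_smul, ?_⟩, edge_of_mem haI rfl⟩
    rw [map_smul, hm.2, ← map_smul, xA_smul_gen, xCoeff, if_pos haI, zA_one_smul]
  · have haJ : a ∉ J.1 := fun h => ha (Finset.mem_sdiff.2 ⟨h, haI⟩)
    obtain ⟨m₁, h1, h2⟩ := ((isEigen_gen a).map f).exists_lift hζ q hq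
    obtain ⟨z, hz⟩ := exists_eq_smul_gen hζ hi hiq (h1.yA_smul.sub hm.1) (by
      rw [map_sub, hm.2, map_smul, h2, ← map_smul, yA_smul_gen, yCoeff, if_neg haI, zA_one_smul,
        sub_self])
    refine ⟨m₁ - i (zA 𝕜 n k t z • gen J Z a), ⟨h1.sub (((isEigen_gen a).zA_smul z).map i), ?_⟩,
      edge_of_notMem haI ?_⟩
    · rw [map_sub, hiq.apply_apply_eq_zero, sub_zero, h2]
    · rw [smul_sub, ← map_smul, yA_zA_smul, yA_smul_gen, yCoeff, if_neg haJ, zA_one_smul, ← hz,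
        sub_sub_cancel]

/-- Mirror image of `IsLift.step_up`: `y` forces the lift when `a ∉ I`, and `x` corrects it when `a
∈ I ∩ J`. -/
theorem IsLift.step_down {a : ZMod n} (ha : a ∉ I.1 \ J.1) {m : M} (hm : IsLift q f a m) :
    ∃ m', IsLift q f (a - 1) m' ∧ Edge 𝕜 t I a m' m := by
  by_cases haI : a ∈ I.1
  · have haJ : a ∈ J.1 := by
      by_contra h
      exact ha (Finset.mem_sdiff.2 ⟨haI, h⟩)
    obtain ⟨m₁, h1, h2⟩ := ((isEigen_gen (a - 1)).map f).exists_lift hζ q hq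
    obtain ⟨z, hz⟩ := exists_eq_smul_gen hζ hi hiq (h1.xA_smul.sub hm.1) (by
      rw [map_sub, hm.2, map_smul, h2, ← map_smul, xA_smul_gen, xCoeff, if_pos haI, zA_one_smul,
        sub_self])
    refine ⟨m₁ - i (zA 𝕜 n k t z • gen J Z (a - 1)),
      ⟨h1.sub (((isEigen_gen (a - 1)).zA_smul z).map i), ?_⟩, edge_of_mem haI ?_⟩
    · rw [map_sub, hiq.apply_apply_eq_zero, sub_zero, h2]
    · rw [smul_sub, ← map_smul, xA_zA_smul, xA_smul_gen, xCoeff, if_pos haJ, zA_one_smul, ← hz,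
        sub_sub_cancel]
  · refine ⟨_, ⟨hm.1.yA_smul, ?_⟩, edge_of_notMem haI rfl⟩
    rw [map_smul, hm.2, ← map_smul, yA_smul_gen, yCoeff, if_neg haI, zA_one_smul]

/-- For non-crossing `I` and `J`, maps out of `L_I` lift along surjections with kernel `L_J`. -/
theorem NonCrossing.exists_lift [IsDomain Z] (ht : t ≠ 0) (h : NonCrossing I.1 J.1)
    (f : L I Z →ₗ[A 𝕜 n k t] Q) : ∃ g : L I Z →ₗ[A 𝕜 n k t] M, q ∘ₗ g = f := by
  obtain ⟨d, hd⟩ := exists_isHeight I J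
  obtain ⟨v, m, hmn, hup, hdown⟩ := h.exists_unimodal hd
  obtain ⟨s₀, hs₀⟩ : ∃ s₀, IsLift q f v s₀ := ((isEigen_gen v).map f).exists_lift hζ q hq
  obtain ⟨σ, hσ0, hσ, hσE⟩ := exists_chain m (fun j x => IsLift q f (v + j) x)
    (fun j x y => Edge 𝕜 t I (v + j + 1) x y) (by simpa using hs₀) (fun j hj x hx => by
      have h1 := IsLift.step_up hζ hi hiq hq (hup j hj) (m := x) (by
        rwa [add_sub_cancel_right])
      rwa [Nat.cast_add, Nat.cast_one, ← add_assoc])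
  obtain ⟨r, rfl⟩ := Nat.exists_eq_add_of_le hmn
  have hcast {j l : ℕ} (hjl : j + l = m + r) : v - (l : ZMod (m + r)) = v + j := by
    have : ((j + l : ℕ) : ZMod (m + r)) = 0 := by rw [hjl]; exact ZMod.natCast_self _
    rw [Nat.cast_add] at this
    linear_combination -this
  -- The backward chain starts from the same lift `s₀` and ends after `r = n - m` steps at the
  -- vertex `v + m`, where the forward chain ends.
  obtain ⟨τ, hτ0, hτ, hτE⟩ := exists_chain r (fun j x => IsLift q f (v - j) x)
    (fun j x y => Edge 𝕜 t I (v - j) y x) (by simpa using hs₀) (fun j hj x hx => by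
      have h0 : v - (j : ZMod (m + r)) = v + (m + r - (j + 1) : ℕ) + 1 := by
        rw [hcast (j := m + r - (j + 1) + 1) (by omega), Nat.cast_add, Nat.cast_one, add_assoc]
      have h1 := IsLift.step_down hζ hi hiq hq (m := x) (a := v - j)
        (by rw [h0]; exact hdown _ (by omega) (by omega)) hx
      rwa [Nat.cast_add, Nat.cast_one, ← sub_sub])
  have hτE' (j : ℕ) (hj : j < r) :
      Edge 𝕜 t I (v + (m + j : ℕ) + 1) (τ (r - j)) (τ (r - (j + 1))) := by
    have h1 := hτE (r - (j + 1)) (by omega)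
    rw [hcast (j := m + j + 1) (by omega), show r - (j + 1) + 1 = r - j by omega] at h1
    rwa [Nat.cast_add _ 1, Nat.cast_one, ← add_assoc] at h1
  have hvm : v - (r : ZMod (m + r)) = v + m := hcast rfl
  have hagree : τ r = σ m := by
    let c (j : ℕ) : Z := xCoeff I.1 t (v + j + 1)
    let c' (j : ℕ) : Z := xCoeff I.1 t (v + (m + j : ℕ) + 1)
    -- Apply `x ^ n` along the loop from `v + m` through `v` back to `v + m`, in any module. Applied
    -- to the generators of `L_I`, it shows that the product of coefficients is `t ^ (n - k)`.
    have key {N : Type u} [AddCommGroup N] [Module (A 𝕜 (m + r) k t) N] (σ τ : ℕ → N)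
        (h0 : τ r = σ 0)
        (h1 : ∀ j < m, xA 𝕜 (m + r) k t • σ j = zA 𝕜 (m + r) k t (c j) • σ (j + 1))
        (h2 : ∀ j < r, xA 𝕜 (m + r) k t • τ j = zA 𝕜 (m + r) k t (c' j) • τ (j + 1)) :
        zA 𝕜 (m + r) k t (t ^ (m + r - k)) • τ 0 = zA 𝕜 (m + r) k t
          ((∏ j ∈ Finset.range r, c' j) * ∏ j ∈ Finset.range m, c j) • σ m := by
      have e1 := xA_pow_smul_chain m σ c h1
      have e2 := xA_pow_smul_chain r τ c' h2
      have hcomm (z : Z) (x : N) (l : ℕ) : xA 𝕜 (m + r) k t ^ l • zA 𝕜 (m + r) k t z • x =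
          zA 𝕜 (m + r) k t z • xA 𝕜 (m + r) k t ^ l • x := by
        rw [← mul_smul, ← mul_smul]
        congr 1
        exact ((show Commute (zA 𝕜 (m + r) k t z) (xA 𝕜 (m + r) k t) from
          zA_mul_xA z).pow_right l).symm.eq
      rw [← xA_pow_n, pow_add, mul_smul, e2, h0, hcomm, e1, zA_zA_smul]
    have e1 := key σ (fun j => τ (r - j)) (by simp only [Nat.sub_self, hτ0, hσ0])
      (fun j hj => (hσE j hj).1) (fun j hj => (hτE' j hj).1)
    have e2 := key (fun j => gen I Z (v + j)) (fun j => gen I Z (v + (m + j : ℕ)))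
      (by simp only [ZMod.natCast_self, Nat.cast_zero])
      (fun j _ => by
        have h1 := xA_smul_gen (𝕜 := 𝕜) (t := t) (I := I) (v + j + 1)
        rw [add_sub_cancel_right] at h1
        rwa [Nat.cast_add, Nat.cast_one, ← add_assoc])
      (fun j _ => by
        have h1 := xA_smul_gen (𝕜 := 𝕜) (t := t) (I := I) (v + (m + j : ℕ) + 1)
        rw [add_sub_cancel_right] at h1
        rwa [← add_assoc, Nat.cast_add _ 1, Nat.cast_one, ← add_assoc])
    have e3 := congrFun e2 (v + m)
    change (zA 𝕜 (m + r) k t _ • gen I Z (v + (m + 0 : ℕ)) : L I Z) (v + m) =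
      (zA 𝕜 (m + r) k t _ • gen I Z (v + (m : ℕ)) : L I Z) (v + m) at e3
    rw [zA_smul_apply, zA_smul_apply, add_zero, gen_self, mul_one, mul_one] at e3
    rw [← e3] at e1
    have hker : q (τ r - σ m) = 0 := by
      rw [map_sub, (hσ m le_rfl).2, (hτ r le_rfl).2, hvm, sub_self]
    obtain ⟨w, hw⟩ := (hiq _).1 hker
    have e4 : i (zA 𝕜 (m + r) k t (t ^ (m + r - k)) • w) = 0 := by
      rw [map_smul, hw, smul_sub, sub_eq_zero]
      exact e1
    have e5 : zA 𝕜 (m + r) k t (t ^ (m + r - k)) • w = 0 := hi (e4.trans (map_zero i).symm)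
    -- `L_J` has no `t`-torsion.
    have e6 : w = 0 := by
      apply L_ext
      intro a
      have e7 := congrFun e5 a
      change (zA 𝕜 (m + r) k t _ • w : L J Z) a = 0 at e7
      rw [zA_smul_apply] at e7
      exact (mul_eq_zero.1 e7).resolve_left (pow_ne_zero _ ht)
    rw [e6, map_zero] at hw
    exact sub_eq_zero.1 hw.symm
  -- Glue the two chains into one family indexed by the distance from `v`.
  let ρ (j : ℕ) : M := if j ≤ m then σ j else τ (m + r - j)
  have hρ1 (j : ℕ) (hj : j ≤ m) : ρ j = σ j := if_pos hj
  have hρ2 (j : ℕ) (hj : m ≤ j) : ρ j = τ (m + r - j) := by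
    rcases Nat.eq_or_lt_of_le hj with rfl | hj
    · rw [hρ1 _ le_rfl, Nat.add_sub_cancel_left, hagree]
    · exact if_neg (by omega)
  have hρE (j : ℕ) (hj : j < m + r) : Edge 𝕜 t I (v + j + 1) (ρ j) (ρ (j + 1)) := by
    rcases Nat.lt_or_ge j m with h1 | h1
    · rw [hρ1 _ h1.le, hρ1 _ h1]
      exact hσE j h1
    · rw [hρ2 _ h1, hρ2 _ (by omega)]
      obtain ⟨l, rfl⟩ := Nat.exists_eq_add_of_le h1
      have h2 := hτE' l (by omega)
      rwa [show r - l = m + r - (m + l) by omega,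
        show r - (l + 1) = m + r - (m + l + 1) by omega] at h2
  have hρL (j : ℕ) (hj : j ≤ m + r) : IsLift q f (v + j) (ρ j) := by
    rcases Nat.lt_or_ge j m with h1 | h1
    · rw [hρ1 _ h1.le]
      exact hσ j h1.le
    · rw [hρ2 _ h1, ← hcast (j := j) (l := m + r - j) (by omega)]
      exact hτ _ (by omega)
  have hρ0 : ρ (m + r) = ρ 0 := by
    rw [hρ2 _ (by omega), hρ1 _ (by omega), Nat.sub_self, hτ0, hσ0]
  have hv (a : ZMod (m + r)) : v + ((a - v).val : ZMod (m + r)) = a := by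
    rw [ZMod.natCast_zmod_val]; ring
  have hL (a : ZMod (m + r)) : IsLift q f a (ρ (a - v).val) := by
    have h1 := hρL (a - v).val (ZMod.val_lt _).le
    rwa [hv] at h1
  have hE (a : ZMod (m + r)) : Edge 𝕜 t I a (ρ (a - 1 - v).val) (ρ (a - v).val) := by
    have h1 := hρE (a - 1 - v).val (ZMod.val_lt _)
    rw [hv, sub_add_cancel] at h1
    have h2 := val_add_one_cases (a - 1 - v)
    rw [show a - 1 - v + 1 = a - v by ring] at h2
    rcases h2 with ⟨h2, -⟩ | ⟨h2, h3⟩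
    · rwa [h2]
    · rw [h3, hρ0] at h1
      rwa [h2]
  obtain ⟨g, hg⟩ := exists_hom_gen (I := I) (fun a => ρ (a - v).val) (fun a => (hL a).1)
    (fun a => (hE a).1) (fun a => (hE a).2)
  refine ⟨g, hom_ext_gen fun a => ?_⟩
  rw [LinearMap.comp_apply, hg, (hL a).2]

end

end Edge

end JKS
end

noncomputable section

namespace JKS

/-! ### The non-liftable map when `I` and `J` cross. -/

section Crossing

variable {𝕜 : Type u} [Field 𝕜] {Z : Type u} [CommRing Z] [Algebra 𝕜 Z] {n k : ℕ}
  [Fact (k < n)] [NeZero n] {t : Z} {M : Type u} [AddCommGroup M] [Module (A 𝕜 n k t) M]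
  {I J : KSubset n k} {d : ZMod n → ℕ}

variable (𝕜 n k t) in
/-- Multiplication by an element of `Z`, as an `A`-linear map. -/
def scalarHom (z : Z) (M : Type u) [AddCommGroup M] [Module (A 𝕜 n k t) M] :
    M →ₗ[A 𝕜 n k t] M :=
  let f : M →+ M := DistribSMul.toAddMonoidHom M (zA 𝕜 n k t z)
  { f with
    map_smul' := map_smul_of_generators f
      (fun m => (xA_zA_smul z m).symm) (fun m => (yA_zA_smul z m).symm)
      (fun w m => by
        change zA 𝕜 n k t z • zA 𝕜 n k t w • m = zA 𝕜 n k t w • zA 𝕜 n k t z • m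
        rw [zA_zA_smul, zA_zA_smul, mul_comm])
      (fun g m => by
        change zA 𝕜 n k t z • gA 𝕜 n k t g • m = gA 𝕜 n k t g • zA 𝕜 n k t z • m
        rw [← mul_smul, ← gA_mul_zA, mul_smul]) }

/-- Together with `IsHeight.yCoeff_mul_pow`, this is what makes sending each generator to `t ^ d`
times its counterpart compatible with `x` and `y`. -/
theorem IsHeight.xCoeff_mul_pow (hd : IsHeight I.1 J.1 d) (t : Z) (a : ZMod n) :
    xCoeff J.1 t a * t ^ d (a - 1) = xCoeff I.1 t a * t ^ d a := by
  have h := hd a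
  unfold xCoeff
  split_ifs at h ⊢
  · simp only [Nat.add_right_cancel h]
  · rw [← pow_succ', one_mul, h, Nat.add_zero]
  · rw [← pow_succ', one_mul, ← h, Nat.add_zero]
  · simp only [Nat.add_right_cancel h]

theorem IsHeight.yCoeff_mul_pow (hd : IsHeight I.1 J.1 d) (t : Z) (a : ZMod n) :
    yCoeff J.1 t a * t ^ d a = yCoeff I.1 t a * t ^ d (a - 1) := by
  have h := hd a
  unfold yCoeff
  split_ifs at h ⊢
  · simp only [Nat.add_right_cancel h]
  · rw [← pow_succ', one_mul, h, Nat.add_zero]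
  · rw [← pow_succ', one_mul, ← h, Nat.add_zero]
  · simp only [Nat.add_right_cancel h]

/-- If `s` is the multiple `t ^ d` of the generators of `L_J` on an arc whose end points are at
height at least `m`, and zero elsewhere, then `s` defines a map from `L_I` to `L_J / t ^ m`. -/
theorem exists_hom_arc (hd : IsHeight I.1 J.1 d) {p q : ZMod n} (N : L J Z →ₗ[A 𝕜 n k t] M)
    (hp : N (zA 𝕜 n k t (t ^ d p) • gen J Z p) = 0)
    (hq : N (zA 𝕜 n k t (t ^ d q) • gen J Z q) = 0) :
    ∃ f : L I Z →ₗ[A 𝕜 n k t] M, ∀ a, f (gen I Z a) =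
      if (a - p).val ≤ (q - p).val then N (zA 𝕜 n k t (t ^ d a) • gen J Z a) else 0 := by
  let s (a : ZMod n) : M :=
    if (a - p).val ≤ (q - p).val then N (zA 𝕜 n k t (t ^ d a) • gen J Z a) else 0
  -- The only edges that cross the boundary of the arc leave it at `q` or enter it at `p`, where the
  -- value is zero anyway.
  have hs (a : ZMod n) : (s (a - 1) = N (zA 𝕜 n k t (t ^ d (a - 1)) • gen J Z (a - 1)) ∧
      s a = N (zA 𝕜 n k t (t ^ d a) • gen J Z a)) ∨ (s (a - 1) = 0 ∧ s a = 0) := by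
    have h := val_add_one_cases (a - 1 - p)
    rw [show a - 1 - p + 1 = a - p by ring] at h
    by_cases h1 : (a - 1 - p).val ≤ (q - p).val <;> by_cases h2 : (a - p).val ≤ (q - p).val
    · exact Or.inl ⟨if_pos h1, if_pos h2⟩
    · have h3 : a - 1 = q := by
        have h4 : (a - 1 - p).val = (q - p).val := by omega
        exact sub_left_injective (ZMod.val_injective n h4)
      refine Or.inr ⟨?_, if_neg h2⟩
      simp only [s, if_pos h1]
      rw [h3, hq]
    · have h3 : a = p := by
        rw [← sub_eq_zero, ← ZMod.val_eq_zero]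
        omega
      refine Or.inr ⟨if_neg h1, ?_⟩
      simp only [s, if_pos h2]
      rw [h3, hp]
    · exact Or.inr ⟨if_neg h1, if_neg h2⟩
  refine exists_hom_gen s (fun a => ?_) (fun a => ?_) (fun a => ?_)
  · by_cases h : (a - p).val ≤ (q - p).val
    · simp only [s, if_pos h]
      exact ((isEigen_gen a).zA_smul _).map N
    · simp only [s, if_neg h]
      intro g
      rw [smul_zero, smul_zero]
  · rcases hs a with ⟨h1, h2⟩ | ⟨h1, h2⟩
    · rw [h1, h2, ← map_smul, ← map_smul, xA_zA_smul, xA_smul_gen, zA_zA_smul, zA_zA_smul,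
        mul_comm, hd.xCoeff_mul_pow]
    · rw [h1, h2, smul_zero, smul_zero]
  · rcases hs a with ⟨h1, h2⟩ | ⟨h1, h2⟩
    · rw [h1, h2, ← map_smul, ← map_smul, yA_zA_smul, yA_smul_gen, zA_zA_smul, zA_zA_smul,
        mul_comm, hd.yCoeff_mul_pow]
    · rw [h1, h2, smul_zero, smul_zero]

theorem xCoeff_ne_zero [IsDomain Z] (ht : t ≠ 0) (a : ZMod n) : xCoeff I.1 t a ≠ 0 := by
  unfold xCoeff
  split_ifs
  · exact one_ne_zero
  · exact ht

/-- Maps `L_I → L_J` are multiples of `t ^ d`, up to a global power of `t`. -/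
theorem IsHeight.pow_mul_hom_gen [IsDomain Z] (ht : t ≠ 0) (hd : IsHeight I.1 J.1 d)
    (hζ : ∃ ζ : 𝕜, IsPrimitiveRoot ζ n) (g : L I Z →ₗ[A 𝕜 n k t] L J Z) (a b : ZMod n) :
    t ^ d a * g (gen I Z b) b = t ^ d b * g (gen I Z a) a := by
  obtain ⟨ζ, hζ⟩ := hζ
  -- Apply `g` to the `x`-relation between neighbouring generators and cancel the nonzero
  -- coefficient.
  have hstep (a : ZMod n) :
      t ^ d a * g (gen I Z (a + 1)) (a + 1) = t ^ d (a + 1) * g (gen I Z a) a := by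
    have h1 := congrArg g (xA_smul_gen (𝕜 := 𝕜) (t := t) (I := I) (a + 1))
    rw [add_sub_cancel_right, map_smul, map_smul] at h1
    have h2 := congrFun h1 (a + 1)
    change (xA 𝕜 n k t • g (gen I Z a) : L J Z) (a + 1) =
      (zA 𝕜 n k t _ • g (gen I Z (a + 1)) : L J Z) (a + 1) at h2
    rw [xA_smul_apply, zA_smul_apply, add_sub_cancel_right] at h2
    have h3 := hd.xCoeff_mul_pow t (a + 1)
    rw [add_sub_cancel_right] at h3
    apply mul_left_cancel₀ (xCoeff_ne_zero (I := I) ht (a + 1))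
    linear_combination (-t ^ d a) * h2 + g (gen I Z a) a * h3
  have h (j : ℕ) : t ^ d a * g (gen I Z (a + j)) (a + j) = t ^ d (a + j) * g (gen I Z a) a := by
    induction j with
    | zero => simp only [Nat.cast_zero, add_zero]
    | succ j ih =>
      have h1 := hstep (a + j)
      rw [Nat.cast_add, Nat.cast_one, ← add_assoc]
      apply mul_left_cancel₀ (pow_ne_zero (d (a + j)) ht)
      linear_combination t ^ d a * h1 + t ^ d (a + j + 1) * ih
  have h1 := h (b - a).val
  rwa [ZMod.natCast_zmod_val, add_sub_cancel] at h1

/-- For crossing `I` and `J` some map from `L_I` to `L_J / t ^ m` does not lift to `L_J`. -/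
theorem nonCrossing_of_subsingleton_ext [IsDomain Z] (ht : t ≠ 0) (htu : ¬ IsUnit t)
    (hζ : ∃ ζ : 𝕜, IsPrimitiveRoot ζ n) [Subsingleton (Ext1 𝕜 t I J)] :
    NonCrossing I.1 J.1 := by
  by_contra hIJ
  obtain ⟨d, hd⟩ := exists_isHeight I J
  obtain ⟨p, q, v₁, v₂, m, hv₁, hv₂, hp, hq, hd₁, hd₂⟩ := exists_two_peaks hIJ hd
  let μ := scalarHom 𝕜 n k t (t ^ m) (L J Z)
  have hμ (v : L J Z) : μ v = zA 𝕜 n k t (t ^ m) • v := rfl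
  have hinj : Function.Injective μ := by
    intro v w hvw
    apply L_ext
    intro a
    have h1 := congrFun hvw a
    change (zA 𝕜 n k t (t ^ m) • v : L J Z) a = (zA 𝕜 n k t (t ^ m) • w : L J Z) a at h1
    rw [zA_smul_apply, zA_smul_apply] at h1
    exact mul_left_cancel₀ (pow_ne_zero _ ht) h1
  obtain ⟨C, _, _, N, hker, hlift⟩ :=
    LinearMap.exists_cokernel_lift_of_subsingleton_ext (B := A 𝕜 n k t) (X := L I Z)
      (Y := L J Z) (M := L J Z) μ hinj
  have hN (v : L J Z) (e : ℕ) (he : m ≤ e) : N (zA 𝕜 n k t (t ^ e) • v) = 0 := by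
    refine (hker _).2 ⟨zA 𝕜 n k t (t ^ (e - m)) • v, ?_⟩
    rw [hμ, zA_zA_smul, ← pow_add, Nat.add_sub_cancel' he]
  obtain ⟨f, hf⟩ := exists_hom_arc hd N (hN _ _ hp) (hN _ _ hq)
  obtain ⟨g, hg⟩ := hlift f
  -- Modulo `t ^ m`, the lift is `t ^ d` at `v₁`, inside the arc, and zero at `v₂`, outside it.
  obtain ⟨z₁, h₁⟩ : ∃ z, g (gen I Z v₁) v₁ = t ^ d v₁ + t ^ m * z := by
    have h1 := hg (gen I Z v₁)
    rw [hf, if_pos hv₁] at h1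
    obtain ⟨w, hw⟩ := (hker (g (gen I Z v₁) - zA 𝕜 n k t (t ^ d v₁) • gen J Z v₁)).1
      (by rw [map_sub, h1, sub_self])
    refine ⟨w v₁, ?_⟩
    have h2 := congrFun hw v₁
    change (zA 𝕜 n k t (t ^ m) • w : L J Z) v₁ =
      g (gen I Z v₁) v₁ - (zA 𝕜 n k t (t ^ d v₁) • gen J Z v₁ : L J Z) v₁ at h2
    rw [zA_smul_apply, zA_smul_apply, gen_self] at h2
    linear_combination -h2
  obtain ⟨z₂, h₂⟩ : ∃ z, g (gen I Z v₂) v₂ = t ^ m * z := by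
    have h1 := hg (gen I Z v₂)
    rw [hf, if_neg (by omega)] at h1
    obtain ⟨w, hw⟩ := (hker _).1 h1
    refine ⟨w v₂, ?_⟩
    have h2 := congrFun hw v₂
    change (zA 𝕜 n k t (t ^ m) • w : L J Z) v₂ = g (gen I Z v₂) v₂ at h2
    rw [zA_smul_apply] at h2
    exact h2.symm
  have h := hd.pow_mul_hom_gen ht hζ g v₁ v₂
  rw [h₁, h₂] at h
  obtain ⟨e₁, he₁⟩ := Nat.exists_eq_add_of_lt hd₁
  obtain ⟨e₂, he₂⟩ := Nat.exists_eq_add_of_lt hd₂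
  -- With `m = d v₁ + e₁ + 1 = d v₂ + e₂ + 1`, cancelling `t ^ (d v₁ + d v₂)` leaves an equation
  -- that exhibits `1` as a multiple of `t`.
  have h3 : t ^ e₂ * t * z₂ = 1 + t ^ e₁ * t * z₁ := by
    apply mul_left_cancel₀ (mul_ne_zero (pow_ne_zero (d v₁) ht) (pow_ne_zero (d v₂) ht))
    have k1 : t ^ m = t ^ d v₁ * t ^ e₁ * t := by rw [he₁]; ring
    have k2 : t ^ m = t ^ d v₂ * t ^ e₂ * t := by rw [he₂]; ring
    linear_combination h - t ^ d v₁ * z₂ * k2 + t ^ d v₂ * z₁ * k1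
  exact htu (IsUnit.of_mul_eq_one (t ^ e₂ * z₂ - t ^ e₁ * z₁) (by linear_combination h3))

theorem subsingleton_ext_iff [IsDomain Z] (ht : t ≠ 0) (htu : ¬ IsUnit t)
    (hζ : ∃ ζ : 𝕜, IsPrimitiveRoot ζ n) :
    Subsingleton (Ext1 𝕜 t I J) ↔ NonCrossing I.1 J.1 := by
  refine ⟨fun _ => nonCrossing_of_subsingleton_ext ht htu hζ, fun h => ?_⟩
  obtain ⟨ζ, hζ⟩ := hζ
  refine subsingleton_ext_of_exists_lift ?_
  intro M Q _ _ _ _ i q hi hiq hq f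
  exact NonCrossing.exists_lift hζ hi hiq hq ht h f

end Crossing

end JKS

end

theorem proposition5p5 (𝕜 : Type u) [Field 𝕜] (n k : ℕ) (hk : 0 < k) [Fact (k < n)]
    (hG : ∃ ζ : 𝕜, IsPrimitiveRoot ζ n) (I J : JKS.KSubset n k) :
    (Subsingleton (JKS.Ext1 𝕜 (Polynomial.X : Polynomial 𝕜) I J) ↔ JKS.NonCrossing I.1 J.1) ∧
    (Subsingleton (JKS.Ext1 𝕜 (PowerSeries.X : PowerSeries 𝕜) I J) ↔
      JKS.NonCrossing I.1 J.1) := by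
  have hkn : k < n := Fact.out
  have : NeZero n := ⟨by omega⟩
  -- Both cases need only that `Z` is a domain in which `t` is neither zero nor a unit.
  exact ⟨JKS.subsingleton_ext_iff Polynomial.X_ne_zero Polynomial.not_isUnit_X hG,
    JKS.subsingleton_ext_iff PowerSeries.X_ne_zero PowerSeries.X_prime.not_isUnit hG⟩
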